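/- **Setting.** Consider a sequence of designs $t=1,2,\dots$; all quantities below depend on $t$ (sample size $n$, number of instruments $K\ge 1$, etc.), and the index is suppressed. Instruments $Z_i\in\mathbb R^K$ and covariates $W_i\in\mathbb R^L$, $i=1,\dots,n$, are nonrandom (conditioned upon). The pairs $(Y_i,X_i)$ of real random variables are independent over $i$ with $Y_i=R_{Yi}+\zeta_i$, $X_i=R_i+\eta_i$, $R_{Yi}=Z_i'\pi_Y+W_i'\gamma_Y$, $R_i=Z_i'\pi+W_i'\gamma$, $E\zeta_i=E\eta_i=0$. Let $G$ be a nonrandom $n\times n$ matrix with $\sum_i\sum_{j\ne i}G_{ij}R_iR_j\neq0$, and put $$\beta=\beta_{JIVE}=\frac{\sum_i\sum_{j\ne i}G_{ij}R_{Yi}R_j}{\sum_i\sum_{j\ne i}G_{ij}R_iR_j},\qquad \hat\beta_{JIVE}=\frac{\sum_i\sum_{j\ne i}G_{ij}Y_iX_j}{\sum_i\sum_{j\ne i}G_{ij}X_iX_j},$$ $R_{\Delta i}=R_{Yi}-R_i\beta$, $\nu_i=\zeta_i-\eta_i\beta$, $e_i(\beta_0)=Y_i-X_i\beta_0$, $$(T_{AR},T_{LM},T_{FS})=\frac1{\sqrt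 K}\sum_i\sum_{j\ne i}G_{ij}\bigl(e_i(\beta_0)e_j(\beta_0),\,e_i(\beta_0)X_j,\,X_iX_j\bigr),$$ $$r=\sum_i\Bigl(\sum_{j\ne i}G_{ij}R_j\Bigr)^2+\sum_i\Bigl(\sum_{j\ne i}G_{ij}R_{\Delta j}\Bigr)^2+\sum_i\sum_{j\ne i}G_{ij}^2 .$$ No restriction is placed on $R_{\Delta i}$ (treatment effects may be heterogeneous), and none beyond (a)–(e) below on the strength of the instruments or on the behaviour of $K$ and $L$ along the sequence. **Assumption.** There are constants $C<\infty$, $\delta>0$, $\underline c>0$ not depending on $t$ such that, for all sufficiently large $t$: (a) $E[\eta_i^4]+E[\nu_i^4]\le C$ for all $i$; (b) $E[\nu_i^2]\ge\delta$, $E[\eta_i^2]\ge\delta$ and $|\mathrm{corr}(\nu_i,\eta_i)|\le1-\delta$ for all $i$; (c) for all real $c_1,c_2,c_3$ with $c_1^2+c_2^2+c_3^2=1$, $$\frac1r\sum_i\Bigl(c_3\sum_{j\ne i}(G_{ij}+G_{ji})R_j+c_2\sum_{j\ne i}G_{ji}R_{\Delta j}\Bigr)^2+\frac1r\sum_i\Bigl(c_1\sum_{j\ne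 i}(G_{ij}+G_{ji})R_{\Delta j}+c_2\sum_{j\ne i}G_{ij}R_j\Bigr)^2+\frac1r\mathrm{Var}\Bigl(\sum_i\sum_{j\ne i}G_{ij}(c_1\nu_i\nu_j+c_2\nu_i\eta_j+c_3\eta_i\eta_j)\Bigr)\ge\underline c ;$$ and, as $t\to\infty$, (d) $\frac1{r^2}\sum_i\Bigl[\bigl(\sum_{j\ne i}G_{ij}R_j\bigr)^4+\bigl(\sum_{j\ne i}G_{ij}R_{\Delta j}\bigr)^4+\bigl(\sum_{j\ne i}G_{ji}R_j\bigr)^4+\bigl(\sum_{j\ne i}G_{ji}R_{\Delta j}\bigr)^4\Bigr]\to0$; (e) $\|\frac1rG_LG_L'\|_F+\|\frac1rG_UG_U'\|_F\to0$, where $G_L$ and $G_U$ are the strictly lower and strictly upper triangular parts of $G$ and $\|\cdot\|_F$ is the Frobenius norm. **Theorem 1.** If the Assumption and the null $\beta=\beta_0$ hold, then $\hat\beta_{JIVE}-\beta_{JIVE}=T_{LM}/T_{FS}$ whenever $\hat\beta_{JIVE}$ is defined (that is, $T_{FS}\ne0$). Moreover, with $V=\mathrm{Var}(T_{AR},T_{LM},T_{FS})$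 the $3\times3$ covariance matrix, $V$ is positive definite for all large $t$ and, as $t\to\infty$, $$V^{-1/2}\begin{pmatrix}T_{AR}-\frac1{\sqrt K}\sum_i\sum_{j\ne i}G_{ij}R_{\Delta i}R_{\Delta j}\\ T_{LM}\\ T_{FS}-\frac1{\sqrt K}\sum_i\sum_{j\ne i}G_{ij}R_iR_j\end{pmatrix}\xrightarrow{d}N(0,I_3).$$ -/

import Mathlib

open MeasureTheory ProbabilityTheory Filter Matrix

noncomputable section

namespace JIVE

/-! ### Leave-one-out sums -/

/-- `∑ᵢ ∑_{j ≠ i} Gᵢⱼ aᵢ bⱼ`. -/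
def offSum {n : ℕ} (G : Matrix (Fin n) (Fin n) ℝ) (a b : Fin n → ℝ) : ℝ :=
  ∑ i, ∑ j ∈ Finset.univ.erase i, G i j * a i * b j

/-- `∑_{j ≠ i} Gᵢⱼ aⱼ`; the sum `∑_{j ≠ i} Gⱼᵢ aⱼ` is `looSum Gᵀ a i`. -/
def looSum {n : ℕ} (G : Matrix (Fin n) (Fin n) ℝ) (a : Fin n → ℝ) (i : Fin n) : ℝ :=
  ∑ j ∈ Finset.univ.erase i, G i j * a j

/-- The strictly lower triangular part, with entries `Gᵢⱼ 1{i > j}`. -/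
def lowerPart {n : ℕ} (G : Matrix (Fin n) (Fin n) ℝ) : Matrix (Fin n) (Fin n) ℝ :=
  Matrix.of fun i j => if j < i then G i j else 0

/-- The strictly upper triangular part, with entries `Gᵢⱼ 1{i < j}`. -/
def upperPart {n : ℕ} (G : Matrix (Fin n) (Fin n) ℝ) : Matrix (Fin n) (Fin n) ℝ :=
  Matrix.of fun i j => if i < j then G i j else 0

open scoped Matrix.Norms.Frobenius in
/-- The Frobenius norm of a square matrix. -/
def frobNorm {n : ℕ} (A : Matrix (Fin n) (Fin n) ℝ) : ℝ := ‖A‖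

open scoped MatrixOrder in
/-- `V ^ (-1/2)`: the inverse of the positive semidefinite square root of `V`. -/
def invSqrt (V : Matrix (Fin 3) (Fin 3) ℝ) : Matrix (Fin 3) (Fin 3) ℝ := (CFC.sqrt V)⁻¹

/-! ### The model -/

/-- The linear instrumental variables model for a sample of `n` individuals with `K` instruments and
`L` covariates, conditionally on instruments and covariates (which are therefore nonrandom).
The pairs `(Yᵢ, Xᵢ)` are independent over `i`, not necessarily identically distributed, and their
means are linear in `(Zᵢ, Wᵢ)`. Nothing relates `πY, γY` to `π, γ`. -/
structure IVModel (n K L : ℕ) {Ω : Type*} [MeasurableSpace Ω] (P : Measure Ω) where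
  /-- instruments, row `i` is `Zᵢ` -/
  Z : Matrix (Fin n) (Fin K) ℝ
  /-- covariates, row `i` is `Wᵢ` -/
  W : Matrix (Fin n) (Fin L) ℝ
  /-- reduced-form coefficients of the outcome -/
  πY : Fin K → ℝ
  γY : Fin L → ℝ
  /-- first-stage coefficients -/
  π : Fin K → ℝ
  γ : Fin L → ℝ
  /-- outcomes -/
  Y : Fin n → Ω → ℝ
  /-- endogenous variables -/
  X : Fin n → Ω → ℝ
  measurable_Y : ∀ i, Measurable (Y i)
  measurable_X : ∀ i, Measurable (X i)
  integrable_Y : ∀ i, Integrable (Y i) P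
  integrable_X : ∀ i, Integrable (X i) P
  mean_Y : ∀ i, ∫ ω, Y i ω ∂P = (Z *ᵥ πY + W *ᵥ γY) i
  mean_X : ∀ i, ∫ ω, X i ω ∂P = (Z *ᵥ π + W *ᵥ γ) i
  indep : iIndepFun (fun i ω => (Y i ω, X i ω)) P

namespace IVModel

variable {n K L : ℕ} {Ω : Type*} [MeasurableSpace Ω] {P : Measure Ω}

/-- `R_{Yi} = Zᵢ'πY + Wᵢ'γY`. -/
def RY (M : IVModel n K L P) : Fin n → ℝ := M.Z *ᵥ M.πY + M.W *ᵥ M.γY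

/-- `Rᵢ = Zᵢ'π + Wᵢ'γ`. -/
def R (M : IVModel n K L P) : Fin n → ℝ := M.Z *ᵥ M.π + M.W *ᵥ M.γ

/-- `ζᵢ = Yᵢ - R_{Yi}`. -/
def ζ (M : IVModel n K L P) (i : Fin n) (ω : Ω) : ℝ := M.Y i ω - M.RY i

/-- `ηᵢ = Xᵢ - Rᵢ`. -/
def η (M : IVModel n K L P) (i : Fin n) (ω : Ω) : ℝ := M.X i ω - M.R i

/-- `R_{Δi} = R_{Yi} - Rᵢ β`. -/
def RΔ (M : IVModel n K L P) (β : ℝ) (i : Fin n) : ℝ := M.RY i - M.R i * β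

/-- `νᵢ = ζᵢ - ηᵢ β`. -/
def ν (M : IVModel n K L P) (β : ℝ) (i : Fin n) (ω : Ω) : ℝ := M.ζ i ω - M.η i ω * β

/-- `eᵢ(β) = Yᵢ - Xᵢ β`. -/
def e (M : IVModel n K L P) (β : ℝ) (i : Fin n) (ω : Ω) : ℝ := M.Y i ω - M.X i ω * β

/-- The estimand `β_JIVE`. -/
def betaJIVE (M : IVModel n K L P) (G : Matrix (Fin n) (Fin n) ℝ) : ℝ :=
  offSum G M.RY M.R / offSum G M.R M.R

/-- The estimator of `β_JIVE`. -/
def betaHat (M : IVModel n K L P) (G : Matrix (Fin n) (Fin n) ℝ) (ω : Ω) : ℝ :=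
  offSum G (fun i => M.Y i ω) (fun i => M.X i ω) / offSum G (fun i => M.X i ω) (fun i => M.X i ω)

/-- `T_AR` with the hypothesized value `β₀` imposed. -/
def TAR (M : IVModel n K L P) (G : Matrix (Fin n) (Fin n) ℝ) (β₀ : ℝ) (ω : Ω) : ℝ :=
  1 / √(K : ℝ) * offSum G (fun i => M.e β₀ i ω) (fun i => M.e β₀ i ω)

/-- `T_LM` with the hypothesized value `β₀` imposed. -/
def TLM (M : IVModel n K L P) (G : Matrix (Fin n) (Fin n) ℝ) (β₀ : ℝ) (ω : Ω) : ℝ :=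
  1 / √(K : ℝ) * offSum G (fun i => M.e β₀ i ω) (fun i => M.X i ω)

/-- `T_FS`. -/
def TFS (M : IVModel n K L P) (G : Matrix (Fin n) (Fin n) ℝ) (ω : Ω) : ℝ :=
  1 / √(K : ℝ) * offSum G (fun i => M.X i ω) (fun i => M.X i ω)

/-- The random vector `(T_AR, T_LM, T_FS)`. -/
def T (M : IVModel n K L P) (G : Matrix (Fin n) (Fin n) ℝ) (β₀ : ℝ) (ω : Ω) : Fin 3 → ℝ :=
  ![M.TAR G β₀ ω, M.TLM G β₀ ω, M.TFS G ω]

/-- The covariance matrix `V = Var(T_AR, T_LM, T_FS)`. -/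
def V (M : IVModel n K L P) (G : Matrix (Fin n) (Fin n) ℝ) (β₀ : ℝ) : Matrix (Fin 3) (Fin 3) ℝ :=
  Matrix.of fun a b => cov[fun ω => M.T G β₀ ω a, fun ω => M.T G β₀ ω b; P]

/-- The centering `(K^{-1/2} ∑ᵢ∑_{j≠i} Gᵢⱼ R_{Δi} R_{Δj}, 0, K^{-1/2} ∑ᵢ∑_{j≠i} Gᵢⱼ Rᵢ Rⱼ)`. -/
def center (M : IVModel n K L P) (G : Matrix (Fin n) (Fin n) ℝ) (β : ℝ) : Fin 3 → ℝ :=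
  ![1 / √(K : ℝ) * offSum G (M.RΔ β) (M.RΔ β), 0, 1 / √(K : ℝ) * offSum G M.R M.R]

/-- `rₙ = ∑ᵢ (∑_{j≠i} Gᵢⱼ Rⱼ)² + ∑ᵢ (∑_{j≠i} Gᵢⱼ R_{Δj})² + ∑ᵢ ∑_{j≠i} Gᵢⱼ²`. -/
def rn (M : IVModel n K L P) (G : Matrix (Fin n) (Fin n) ℝ) (β : ℝ) : ℝ :=
  ∑ i, looSum G M.R i ^ 2 + ∑ i, looSum G (M.RΔ β) i ^ 2
    + ∑ i, ∑ j ∈ Finset.univ.erase i, G i j ^ 2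

/-- The correlation of `νᵢ` and `ηᵢ`. -/
def corr (M : IVModel n K L P) (β : ℝ) (i : Fin n) : ℝ :=
  cov[M.ν β i, M.η i; P] / (√(Var[M.ν β i; P]) * √(Var[M.η i; P]))

/-- The quadratic form in `(c₁, c₂, c₃)` that bounds the variance of
`c₁ T_AR + c₂ T_LM + c₃ T_FS` (scaled by `K / rₙ`) from below. -/
def nondegForm (M : IVModel n K L P) (G : Matrix (Fin n) (Fin n) ℝ) (β c₁ c₂ c₃ : ℝ) : ℝ :=
  1 / M.rn G β * ∑ i, (c₃ * ∑ j ∈ Finset.univ.erase i, (G i j + G j i) * M.R j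
      + c₂ * looSum Gᵀ (M.RΔ β) i) ^ 2
  + 1 / M.rn G β * ∑ i, (c₁ * ∑ j ∈ Finset.univ.erase i, (G i j + G j i) * M.RΔ β j
      + c₂ * looSum G M.R i) ^ 2
  + 1 / M.rn G β * Var[fun ω => ∑ i, ∑ j ∈ Finset.univ.erase i, G i j *
      (c₁ * M.ν β i ω * M.ν β j ω + c₂ * M.ν β i ω * M.η j ω + c₃ * M.η i ω * M.η j ω); P]

end IVModel

/-! ### The regularity assumption -/

/-- The moment and weight conditions on a sequence of designs. The bounds that do not depend on the
design are required for all large `t`. -/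
structure NormalityAssumption {Ω : ℕ → Type*} [∀ t, MeasurableSpace (Ω t)]
    {P : ∀ t, Measure (Ω t)} {n K L : ℕ → ℕ}
    (M : ∀ t, IVModel (n t) (K t) (L t) (P t))
    (G : ∀ t, Matrix (Fin (n t)) (Fin (n t)) ℝ) (β : ℕ → ℝ) : Prop where
  /-- (a) bounded fourth moments -/
  moments : ∃ C : ℝ, ∀ᶠ t in atTop, ∀ i,
    MemLp ((M t).η i) 4 (P t) ∧ MemLp ((M t).ν (β t) i) 4 (P t) ∧
      ∫ ω, (M t).η i ω ^ 4 ∂(P t) + ∫ ω, (M t).ν (β t) i ω ^ 4 ∂(P t) ≤ C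
  /-- (b) variances bounded away from `0`, correlations bounded away from `1` in absolute value -/
  nondeg_errors : ∃ δ : ℝ, 0 < δ ∧ ∀ᶠ t in atTop, ∀ i,
    δ ≤ ∫ ω, (M t).ν (β t) i ω ^ 2 ∂(P t) ∧ δ ≤ ∫ ω, (M t).η i ω ^ 2 ∂(P t) ∧
      |(M t).corr (β t) i| ≤ 1 - δ
  /-- (c) nondegenerate variance, uniformly over directions `(c₁, c₂, c₃)` -/
  nondeg_var : ∃ c : ℝ, 0 < c ∧ ∀ᶠ t in atTop, ∀ c₁ c₂ c₃ : ℝ, c₁ ^ 2 + c₂ ^ 2 + c₃ ^ 2 = 1 →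
    c ≤ (M t).nondegForm (G t) (β t) c₁ c₂ c₃
  /-- (d) the weights on the linear terms are negligible -/
  linear_weights : Tendsto (fun t => 1 / (M t).rn (G t) (β t) ^ 2 *
      ∑ i, (looSum (G t) (M t).R i ^ 4 + looSum (G t) ((M t).RΔ (β t)) i ^ 4
        + looSum (G t)ᵀ (M t).R i ^ 4 + looSum (G t)ᵀ ((M t).RΔ (β t)) i ^ 4)) atTop (nhds 0)
  /-- (e) the weights on the quadratic terms are negligible -/
  quadratic_weights : Tendsto (fun t =>
      frobNorm ((1 / (M t).rn (G t) (β t)) • (lowerPart (G t) * (lowerPart (G t))ᵀ))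
      + frobNorm ((1 / (M t).rn (G t) (β t)) • (upperPart (G t) * (upperPart (G t))ᵀ)))
    atTop (nhds 0)

end JIVE

end

/-!
Under the null, a combination of the centered statistics with weights `c` equals, up to the factor
`√K`, a linear plus a quadratic form in the errors `(νᵢ, ηᵢ)` (`IVModel.sum_mul_T_sub_center`); the
mean of `T_LM` vanishes because `∑ᵢ∑_{j≠i} Gᵢⱼ R_{Δi} Rⱼ = 0` by definition of `β_JIVE`. Collecting
the terms of the quadratic form by their larger index exhibits it as a sum of martingale differences
`∑ₖ (aₖ νₖ + bₖ ηₖ)` in which `aₖ` and `bₖ` are affine in the errors with index below `k`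
(`chaosDiff`).

Asymptotic normality of such sums is proved by characteristic functions. For martingale differences
`Mₖ` with conditional variances `sₖ`, `IsMartingaleDiff.norm_charFun_sub_le` bounds the distance of
`E exp (i ∑ Mₖ)` to `exp (-v / 2)` by `∑ E|Mₖ|³ + ∑ E sₖ² + E|∑ sₖ - v|`, up to a constant: multiply
by `exp (∑ sₖ / 2)`, telescope, and stop before the accumulated conditional variance exceeds `v + 1`.
For the present differences the first two sums are of the order of fourth powers of the linear
weights plus `‖Q Qᵀ‖_F²`, where `Q` runs through the strictly triangular blocks of the quadratic form.
The accumulated conditional variance is a polynomial of degree two in the errors; its variance is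
bounded by `‖Q Qᵀ‖_F² + ‖Q Qᵀ‖_F ‖A‖²`, where `A` is the vector of linear weights
(`variance_sum_chaosVar_le`). This gives the quantitative limit theorem `norm_charFun_chaos_sub_le`.

Linear and quadratic part are uncorrelated, and the covariance matrix of `(νᵢ, ηᵢ)` has eigenvalues
bounded away from zero. So `nondeg_var` bounds the variance of the combination below by a multiple
of `rₙ |c|²` (`IVModel.MomentBound.le_integral_sq_chaos`), which makes `V` positive definite. For
`√K c = V^{-1/2} u` the variance is `|u|²`; hence `rₙ |c|²` and `‖A‖²` are bounded, and
`linear_weights` and `quadratic_weights` make the error vanish for every direction `u`. Lévy's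
continuity theorem concludes.
-/

namespace JIVE

/-! ### Martingale difference arrays -/

lemma norm_cexp_sub_quadratic_le (x : ℝ) :
    ‖Complex.exp (x * Complex.I) - (1 + x * Complex.I - (x : ℂ) ^ 2 / 2)‖ ≤ 4 * |x| ^ 3 := by
  have hx : ‖(x : ℂ) * Complex.I‖ = |x| := by simp
  rcases le_total |x| 1 with h | h
  · have := Complex.exp_bound (x := x * Complex.I) (by rw [hx]; exact h) (n := 3) (by norm_num)
    have e : (∑ m ∈ Finset.range 3, ((x : ℂ) * Complex.I) ^ m / (m.factorial : ℂ))
        = 1 + x * Complex.I - (x : ℂ) ^ 2 / 2 := by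
      simp [Finset.sum_range_succ, mul_pow, Nat.factorial]
      ring
    rw [e, hx] at this
    refine this.trans ?_
    have h3 : 0 ≤ |x| ^ 3 := by positivity
    norm_num [Nat.factorial]
    linarith
  · have h1 : ‖Complex.exp (x * Complex.I)‖ = 1 := Complex.norm_exp_ofReal_mul_I x
    have h2 : ‖(1 + x * Complex.I - (x : ℂ) ^ 2 / 2)‖ ≤ 1 + |x| + |x| ^ 2 / 2 := by
      refine (norm_sub_le _ _).trans ?_
      refine add_le_add ((norm_add_le _ _).trans ?_) ?_
      · simp
      · simp
    refine (norm_sub_le _ _).trans ?_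
    have h4 : |x| ≤ |x| ^ 3 := by nlinarith [abs_nonneg x, mul_self_nonneg (|x|)]
    have h5 : |x| ^ 2 ≤ |x| ^ 3 := by nlinarith [sq_nonneg (|x|)]
    nlinarith

lemma abs_exp_neg_half_sub_le {s : ℝ} (hs : 0 ≤ s) : |Real.exp (-s / 2) - (1 - s / 2)| ≤ s ^ 2 := by
  rcases le_total s 2 with h | h
  · have h2 : |-s / 2| ≤ 1 := by rw [abs_le]; constructor <;> linarith
    have := Real.abs_exp_sub_one_sub_id_le h2
    have e : Real.exp (-s / 2) - 1 - -s / 2 = Real.exp (-s / 2) - (1 - s / 2) := by ring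
    rw [e] at this
    nlinarith
  · have h1 : Real.exp (-s / 2) ≤ 1 := Real.exp_le_one_iff.2 (by linarith)
    have h0 := Real.exp_pos (-s / 2)
    rw [abs_le]
    constructor <;> nlinarith

lemma norm_cexp_sub_exp_le (x : ℝ) {s : ℝ} (hs : 0 ≤ s) :
    ‖Complex.exp (x * Complex.I) - Complex.exp ((-s / 2 : ℝ))
      - (x * Complex.I - ((x : ℂ) ^ 2 - s) / 2)‖ ≤ 4 * |x| ^ 3 + s ^ 2 := by
  have e : Complex.exp (x * Complex.I) - Complex.exp ((-s / 2 : ℝ))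
      - (x * Complex.I - ((x : ℂ) ^ 2 - s) / 2)
      = (Complex.exp (x * Complex.I) - (1 + x * Complex.I - (x : ℂ) ^ 2 / 2))
        - ((Real.exp (-s / 2) - (1 - s / 2) : ℝ) : ℂ) := by
    push_cast
    ring
  rw [e]
  refine (norm_sub_le _ _).trans (add_le_add (norm_cexp_sub_quadratic_le x) ?_)
  rw [Complex.norm_real]
  exact abs_exp_neg_half_sub_le hs

/-- `s k` is a version of the conditional variance of the martingale difference `M k` given `ℱ k`.
Conditional expectations are tested against bounded complex-valued `ℱ k`-measurable weights. -/
structure IsMartingaleDiff {Ω : Type*} [MeasurableSpace Ω] (μ : Measure Ω) {n : ℕ}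
    (ℱ : ℕ → MeasurableSpace Ω) (M s : Fin n → Ω → ℝ) : Prop where
  measurable_diff : ∀ k : Fin n, Measurable[ℱ (k + 1)] (M k)
  measurable_var : ∀ k : Fin n, Measurable[ℱ k] (s k)
  var_nonneg : ∀ k ω, 0 ≤ s k ω
  memLp_diff : ∀ k, MemLp (M k) 4 μ
  memLp_var : ∀ k, MemLp (s k) 2 μ
  integral_diff : ∀ (k : Fin n) (W : Ω → ℂ) (c : ℝ), Measurable[ℱ k] W → (∀ ω, ‖W ω‖ ≤ c) →
    ∫ ω, W ω * M k ω ∂μ = 0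
  integral_sq : ∀ (k : Fin n) (W : Ω → ℂ) (c : ℝ), Measurable[ℱ k] W → (∀ ω, ‖W ω‖ ≤ c) →
    ∫ ω, W ω * ((M k ω : ℂ) ^ 2 - s k ω) ∂μ = 0

section

variable {Ω : Type*} [mΩ : MeasurableSpace Ω] {μ : Measure Ω} [IsProbabilityMeasure μ] {n : ℕ}
  {ℱ : ℕ → MeasurableSpace Ω} {M s : Fin n → Ω → ℝ}

lemma _root_.MeasureTheory.MemLp.integrable_abs_pow_three {f : Ω → ℝ} (hf : MemLp f 4 μ) :
    Integrable (fun ω => |f ω| ^ 3) μ := by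
  have h3 : MemLp f ((3 : ℕ) : ENNReal) μ := hf.mono_exponent (by norm_cast)
  exact h3.integrable_norm_pow (by norm_num)

omit [IsProbabilityMeasure μ] in
lemma _root_.MeasureTheory.MemLp.integrable_pow_four {f : Ω → ℝ} (hf : MemLp f 4 μ) :
    Integrable (fun ω => f ω ^ 4) μ := by
  have h4 : MemLp f ((4 : ℕ) : ENNReal) μ := by exact_mod_cast hf
  have := h4.integrable_norm_pow (by norm_num)
  refine this.congr (ae_of_all _ fun ω => ?_)
  simp only [Real.norm_eq_abs]
  exact Even.pow_abs (by decide) _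

/-- Telescoping over the last difference: each factor `exp (i M k + s k / 2)` has conditional
expectation close to `1`. -/
theorem IsMartingaleDiff.norm_integral_cexp_sub_one_le (hℱ : Monotone ℱ) (hle : ∀ k, ℱ k ≤ mΩ)
    (h : IsMartingaleDiff μ ℱ M s) {B : ℝ} (hB : ∀ ω, ∑ k, s k ω ≤ B) :
    ‖∫ ω, Complex.exp ((∑ k, M k ω : ℝ) * Complex.I + (∑ k, s k ω / 2 : ℝ)) ∂μ - 1‖
      ≤ Real.exp (B / 2) * ∑ k, ∫ ω, (4 * |M k ω| ^ 3 + s k ω ^ 2) ∂μ := by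
  induction n with
  | zero => simp
  | succ n ih =>
    have hM' : ∀ k, Measurable (M k) := fun k => (h.measurable_diff k).mono (hle _) le_rfl
    have hs' : ∀ k, Measurable (s k) := fun k => (h.measurable_var k).mono (hle _) le_rfl
    have h' : IsMartingaleDiff μ ℱ (fun k : Fin n => M k.castSucc) (fun k => s k.castSucc) :=
      ⟨fun k => h.measurable_diff k.castSucc, fun k => h.measurable_var k.castSucc,
        fun k => h.var_nonneg _, fun k => h.memLp_diff _, fun k => h.memLp_var _,
        fun k => h.integral_diff k.castSucc, fun k => h.integral_sq k.castSucc⟩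
    have hB' : ∀ ω, ∑ k : Fin n, s k.castSucc ω ≤ B := fun ω => by
      have := hB ω
      rw [Fin.sum_univ_castSucc] at this
      linarith [h.var_nonneg (Fin.last n) ω]
    have IH := ih h' hB'
    set W : Ω → ℂ := fun ω => Complex.exp ((∑ k : Fin n, M k.castSucc ω : ℝ) * Complex.I
      + (∑ k, s k ω / 2 : ℝ)) with hW
    have hWm : Measurable[ℱ n] W := by
      have a1 : Measurable[ℱ n] (fun ω => ∑ k : Fin n, M k.castSucc ω) :=
        Finset.measurable_fun_sum _ fun k _ =>
          (h.measurable_diff k.castSucc).mono (hℱ (by simp)) le_rfl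
      have a2 : Measurable[ℱ n] (fun ω => ∑ k, s k ω / 2) :=
        Finset.measurable_fun_sum _ fun k _ =>
          ((h.measurable_var k).mono (hℱ (by omega)) le_rfl).div_const 2
      exact Complex.measurable_exp.comp
        (((Complex.measurable_ofReal.comp a1).mul_const _).add (Complex.measurable_ofReal.comp a2))
    have hWb : ∀ ω, ‖W ω‖ ≤ Real.exp (B / 2) := fun ω => by
      rw [hW, Complex.norm_exp]
      simp only [Complex.add_re, Complex.mul_re, Complex.ofReal_re, Complex.I_re, mul_zero,
        Complex.ofReal_im, Complex.I_im, mul_one, sub_self, zero_add]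
      rw [← Finset.sum_div]
      exact Real.exp_le_exp.2 (by linarith [hB ω])
    have hWm' : Measurable W := hWm.mono (hle _) le_rfl
    have e1 : ∀ ω, Complex.exp ((∑ k, M k ω : ℝ) * Complex.I + (∑ k, s k ω / 2 : ℝ))
        = W ω * Complex.exp (M (Fin.last n) ω * Complex.I) := fun ω => by
      rw [hW, ← Complex.exp_add, Fin.sum_univ_castSucc (fun k => M k ω)]
      congr 1
      push_cast
      ring
    have e2 : ∀ ω, Complex.exp ((∑ k : Fin n, M k.castSucc ω : ℝ) * Complex.I
        + (∑ k : Fin n, s k.castSucc ω / 2 : ℝ))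
        = W ω * Complex.exp ((-s (Fin.last n) ω / 2 : ℝ)) := fun ω => by
      rw [hW, ← Complex.exp_add, Fin.sum_univ_castSucc (fun k => s k ω / 2)]
      congr 1
      push_cast
      ring
    have hbdd : ∀ g : Ω → ℂ, Measurable g → (∀ ω, ‖g ω‖ ≤ 1) →
        Integrable (fun ω => W ω * g ω) μ := fun g hg hg1 => by
      refine Integrable.of_bound (C := Real.exp (B / 2)) (hWm'.mul hg).aestronglyMeasurable
        (ae_of_all _ fun ω => ?_)
      rw [norm_mul]
      exact (mul_le_of_le_one_right (norm_nonneg _) (hg1 ω)).trans (hWb ω)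
    have hWint : ∀ g : Ω → ℂ, Integrable g μ → Integrable (fun ω => W ω * g ω) μ := fun g hg =>
      hg.bdd_mul hWm'.aestronglyMeasurable (ae_of_all _ hWb)
    have i1 : Integrable (fun ω => W ω * Complex.exp (M (Fin.last n) ω * Complex.I)) μ :=
      hbdd _ (Complex.measurable_exp.comp ((Complex.measurable_ofReal.comp (hM' _)).mul_const _))
        fun ω => (Complex.norm_exp_ofReal_mul_I _).le
    have i2 : Integrable (fun ω => W ω * Complex.exp ((-s (Fin.last n) ω / 2 : ℝ))) μ :=
      hbdd _ (Complex.measurable_exp.comp (Complex.measurable_ofReal.comp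
        ((hs' _).neg.div_const _))) fun ω => by
          rw [← Complex.ofReal_exp, Complex.norm_real, Real.norm_eq_abs, Real.abs_exp]
          exact Real.exp_le_one_iff.2 (by linarith [h.var_nonneg (Fin.last n) ω])
    have hM2 : MemLp (M (Fin.last n)) 2 μ := (h.memLp_diff _).mono_exponent (by norm_num)
    have i3 : Integrable (fun ω => W ω * (M (Fin.last n) ω : ℂ)) μ :=
      hWint _ (hM2.integrable (by norm_num)).ofReal
    have i4 : Integrable (fun ω => W ω * ((M (Fin.last n) ω : ℂ) ^ 2 - s (Fin.last n) ω)) μ := by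
      refine hWint _ ?_
      have := (hM2.integrable_sq.sub ((h.memLp_var (Fin.last n)).integrable (by norm_num))).ofReal
        (𝕜 := ℂ)
      simpa using this
    have key : ∫ ω, W ω * Complex.exp (M (Fin.last n) ω * Complex.I) ∂μ
        - ∫ ω, W ω * Complex.exp ((-s (Fin.last n) ω / 2 : ℝ)) ∂μ
        = ∫ ω, W ω * (Complex.exp (M (Fin.last n) ω * Complex.I)
          - Complex.exp ((-s (Fin.last n) ω / 2 : ℝ))
          - (M (Fin.last n) ω * Complex.I - ((M (Fin.last n) ω : ℂ) ^ 2 - s (Fin.last n) ω) / 2))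
            ∂μ := by
      have z1 := h.integral_diff (Fin.last n) W _ hWm hWb
      have z2 := h.integral_sq (Fin.last n) W _ hWm hWb
      have : ∀ ω, W ω * (Complex.exp (M (Fin.last n) ω * Complex.I)
          - Complex.exp ((-s (Fin.last n) ω / 2 : ℝ))
          - (M (Fin.last n) ω * Complex.I - ((M (Fin.last n) ω : ℂ) ^ 2 - s (Fin.last n) ω) / 2))
          = (W ω * Complex.exp (M (Fin.last n) ω * Complex.I)
          - W ω * Complex.exp ((-s (Fin.last n) ω / 2 : ℝ)))
          - ((W ω * M (Fin.last n) ω) * Complex.I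
            - (W ω * ((M (Fin.last n) ω : ℂ) ^ 2 - s (Fin.last n) ω)) / 2) := fun ω => by ring
      simp_rw [this]
      have j3 := i3.mul_const Complex.I
      have j4 := i4.div_const 2
      have y1 := integral_sub (i1.sub i2) (j3.sub j4)
      have y2 := integral_sub i1 i2
      have y3 := integral_sub j3 j4
      rw [integral_mul_const, integral_div, z1, z2] at y3
      simp only [Pi.sub_apply] at y1
      rw [y1, y2, y3]
      simp
    have bound : ‖∫ ω, W ω * Complex.exp (M (Fin.last n) ω * Complex.I) ∂μ
        - ∫ ω, W ω * Complex.exp ((-s (Fin.last n) ω / 2 : ℝ)) ∂μ‖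
        ≤ Real.exp (B / 2) * ∫ ω, (4 * |M (Fin.last n) ω| ^ 3 + s (Fin.last n) ω ^ 2) ∂μ := by
      rw [key, ← integral_const_mul]
      refine norm_integral_le_of_norm_le ?_ (ae_of_all _ fun ω => ?_)
      · exact (((h.memLp_diff _).integrable_abs_pow_three.const_mul 4).add
          (h.memLp_var _).integrable_sq).const_mul _
      · rw [norm_mul]
        exact mul_le_mul (hWb ω) (norm_cexp_sub_exp_le _ (h.var_nonneg _ _)) (norm_nonneg _)
          (Real.exp_pos _).le
    simp_rw [e1]
    simp_rw [e2] at IH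
    rw [Fin.sum_univ_castSucc, mul_add]
    refine le_trans ?_ (add_le_add IH bound)
    rw [add_comm]
    refine le_trans (le_of_eq ?_) (norm_add_le _ _)
    congr 1
    ring

omit [IsProbabilityMeasure μ] in
/-- Multiplying by indicators of predictable events preserves the martingale difference property. -/
lemma IsMartingaleDiff.indicator (hle : ∀ k, ℱ k ≤ mΩ) (hℱ : Monotone ℱ)
    (h : IsMartingaleDiff μ ℱ M s) {A : Fin n → Set Ω} (hA : ∀ k : Fin n, MeasurableSet[ℱ k] (A k)) :
    IsMartingaleDiff μ ℱ (fun k => (A k).indicator (M k)) (fun k => (A k).indicator (s k)) where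
  measurable_diff k := (h.measurable_diff k).indicator (hℱ (Nat.le_succ _) _ (hA k))
  measurable_var k := (h.measurable_var k).indicator (hA k)
  var_nonneg k ω := Set.indicator_nonneg (fun ω _ => h.var_nonneg k ω) ω
  memLp_diff k := (h.memLp_diff k).indicator (hle _ _ (hA k))
  memLp_var k := (h.memLp_var k).indicator (hle _ _ (hA k))
  integral_diff k W c hW hc := by
    have hc' : ∀ ω, ‖(A k).indicator W ω‖ ≤ c := fun ω =>
      (norm_indicator_le_norm_self W ω).trans (hc ω)
    rw [← h.integral_diff k ((A k).indicator W) c (hW.indicator (hA k)) hc']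
    refine integral_congr_ae (ae_of_all _ fun ω => ?_)
    by_cases hω : ω ∈ A k <;> simp [hω]
  integral_sq k W c hW hc := by
    have hc' : ∀ ω, ‖(A k).indicator W ω‖ ≤ c := fun ω =>
      (norm_indicator_le_norm_self W ω).trans (hc ω)
    rw [← h.integral_sq k ((A k).indicator W) c (hW.indicator (hA k)) hc']
    refine integral_congr_ae (ae_of_all _ fun ω => ?_)
    by_cases hω : ω ∈ A k <;> simp [hω]

lemma sum_indicator_le {B : ℝ} (hB : 0 ≤ B) {a : Fin n → ℝ} (ha : ∀ k, 0 ≤ a k) :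
    ∑ k, (if ∑ j ∈ Finset.Iic k, a j ≤ B then a k else 0) ≤ B := by
  rw [← Finset.sum_filter]
  set F := Finset.univ.filter fun k => ∑ j ∈ Finset.Iic k, a j ≤ B
  rcases F.eq_empty_or_nonempty with h | h
  · rw [h]; simpa using hB
  · have hmem := F.max'_mem h
    refine le_trans ?_ (Finset.mem_filter.1 hmem).2
    refine Finset.sum_le_sum_of_subset_of_nonneg (fun k hk => ?_) fun k _ _ => ha k
    exact Finset.mem_Iic.2 (F.le_max' k hk)

/-- A quantitative martingale central limit theorem on the level of characteristic functions. The
differences are stopped before the accumulated conditional variance exceeds `v + 1`, which keeps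
the compensating factor `exp (∑ s k / 2)` bounded. -/
theorem IsMartingaleDiff.norm_charFun_sub_le (hℱ : Monotone ℱ) (hle : ∀ k, ℱ k ≤ mΩ)
    (h : IsMartingaleDiff μ ℱ M s) {v : ℝ} (hv : 0 ≤ v) :
    ‖∫ ω, Complex.exp ((∑ k, M k ω : ℝ) * Complex.I) ∂μ - (Real.exp (-v / 2) : ℝ)‖
      ≤ 2 * (∑ k, ∫ ω, (4 * |M k ω| ^ 3 + s k ω ^ 2) ∂μ + 2 * ∫ ω, |∑ k, s k ω - v| ∂μ) := by
  have hMm : ∀ k, Measurable (M k) := fun k => (h.measurable_diff k).mono (hle _) le_rfl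
  have hsm : ∀ k, Measurable (s k) := fun k => (h.measurable_var k).mono (hle _) le_rfl
  set A : Fin n → Set Ω := fun k => {ω | ∑ j ∈ Finset.Iic k, s j ω ≤ v + 1} with hAdef
  have hA : ∀ k : Fin n, MeasurableSet[ℱ k] (A k) := fun k => by
    have : Measurable[ℱ k] fun ω => ∑ j ∈ Finset.Iic k, s j ω :=
      Finset.measurable_fun_sum _ fun j hj => (h.measurable_var j).mono
        (hℱ (Fin.le_def.1 (Finset.mem_Iic.1 hj))) le_rfl
    exact this measurableSet_Iic
  have hA' : ∀ k, MeasurableSet (A k) := fun k => hle _ _ (hA k)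
  have h' := h.indicator hle hℱ hA
  have hB : ∀ ω, ∑ k, (A k).indicator (s k) ω ≤ v + 1 := fun ω => by
    have := sum_indicator_le (a := fun k => s k ω) (B := v + 1) (by linarith)
      (fun k => h.var_nonneg k ω)
    simpa [Set.indicator_apply, hAdef] using this
  have hB0 : ∀ ω, 0 ≤ ∑ k, (A k).indicator (s k) ω := fun ω =>
    Finset.sum_nonneg fun k _ => h'.var_nonneg k ω
  have htel := h'.norm_integral_cexp_sub_one_le hℱ hle hB
  have hR : ∑ k, ∫ ω, (4 * |(A k).indicator (M k) ω| ^ 3 + (A k).indicator (s k) ω ^ 2) ∂μ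
      ≤ ∑ k, ∫ ω, (4 * |M k ω| ^ 3 + s k ω ^ 2) ∂μ := by
    refine Finset.sum_le_sum fun k _ => integral_mono ?_ ?_ fun ω => ?_
    · exact ((h'.memLp_diff _).integrable_abs_pow_three.const_mul 4).add
        (h'.memLp_var _).integrable_sq
    · exact ((h.memLp_diff _).integrable_abs_pow_three.const_mul 4).add
        (h.memLp_var _).integrable_sq
    · by_cases hω : ω ∈ A k
      · simp [hω]
      · simp only [hω, not_false_eq_true, Set.indicator_of_notMem, abs_zero]
        have := pow_nonneg (abs_nonneg (M k ω)) 3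
        nlinarith [sq_nonneg (s k ω)]
  set f : Ω → ℂ := fun ω => Complex.exp ((∑ k, M k ω : ℝ) * Complex.I) with hf
  set g : Ω → ℂ := fun ω => Complex.exp ((∑ k, (A k).indicator (M k) ω : ℝ) * Complex.I
    + (∑ k, (A k).indicator (s k) ω / 2 : ℝ)) with hg
  have hfm : Measurable f := by
    have : Measurable fun ω => ∑ k, M k ω := Finset.measurable_fun_sum _ fun k _ => hMm k
    fun_prop
  have hgm : Measurable g := by
    have a1 : Measurable fun ω => ∑ k, (A k).indicator (M k) ω :=
      Finset.measurable_fun_sum _ fun k _ => (hMm k).indicator (hA' k)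
    have a2 : Measurable fun ω => ∑ k, (A k).indicator (s k) ω / 2 :=
      Finset.measurable_fun_sum _ fun k _ => ((hsm k).indicator (hA' k)).div_const 2
    fun_prop
  have hfn : ∀ ω, ‖f ω‖ = 1 := fun ω => Complex.norm_exp_ofReal_mul_I _
  have hgn : ∀ ω, ‖g ω‖ = Real.exp (∑ k, (A k).indicator (s k) ω / 2) := fun ω => by
    rw [hg, Complex.norm_exp]
    simp
  have hgB : ∀ ω, ‖g ω‖ ≤ Real.exp ((v + 1) / 2) := fun ω => by
    rw [hgn, ← Finset.sum_div]
    exact Real.exp_le_exp.2 (by linarith [hB ω])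
  have hfi : Integrable f μ := Integrable.of_bound hfm.aestronglyMeasurable 1
    (ae_of_all _ fun ω => (hfn ω).le)
  have hgi : Integrable g μ := Integrable.of_bound hgm.aestronglyMeasurable _ (ae_of_all _ hgB)
  have hVi : Integrable (fun ω => |∑ k, s k ω - v|) μ :=
    ((integrable_finsetSum _ fun k _ => (h.memLp_var k).integrable (by norm_num)).sub
      (integrable_const v)).abs
  have hpt : ∀ ω, ‖(Real.exp (v / 2) : ℂ) * f ω - g ω‖
      ≤ 2 * Real.exp ((v + 1) / 2) * |∑ k, s k ω - v| := fun ω => by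
    rcases le_or_gt (∑ k, s k ω) (v + 1) with hω | hω
    · have hmem : ∀ k, ω ∈ A k := fun k =>
        (Finset.sum_le_sum_of_subset_of_nonneg (Finset.subset_univ _)
          fun j _ _ => h.var_nonneg j ω).trans hω
      have e : g ω = (Real.exp (∑ k, s k ω / 2) : ℂ) * f ω := by
        simp only [hg, hf, hmem, Set.indicator_of_mem]
        rw [Complex.exp_add, mul_comm, Complex.ofReal_exp]
      rw [e, ← sub_mul, norm_mul, hfn, mul_one, ← Complex.ofReal_sub, Complex.norm_real,
        Real.norm_eq_abs, ← Finset.sum_div, abs_sub_comm]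
      -- the exponential is Lipschitz on `(-∞, (v + 1) / 2]`
      have lip : ∀ a b : ℝ, a ≤ b → b ≤ (v + 1) / 2 →
          |Real.exp b - Real.exp a| ≤ Real.exp ((v + 1) / 2) * (b - a) := fun a b hab hb => by
        rw [abs_of_nonneg (sub_nonneg.2 (Real.exp_le_exp.2 hab))]
        have h1 := Real.add_one_le_exp (a - b)
        have h2 : Real.exp a = Real.exp b * Real.exp (a - b) := by
          rw [← Real.exp_add]; congr 1; ring
        have h3 := Real.exp_le_exp.2 hb
        have h4 := Real.exp_pos b
        rw [h2]
        nlinarith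
      have hpos := Real.exp_pos ((v + 1) / 2)
      rcases le_total (∑ k, s k ω) v with hc | hc
      · rw [abs_sub_comm, abs_of_nonpos (by linarith : ∑ k, s k ω - v ≤ 0)]
        refine (lip _ _ (by linarith) (by linarith)).trans ?_
        nlinarith
      · rw [abs_of_nonneg (by linarith : 0 ≤ ∑ k, s k ω - v)]
        refine (lip _ _ (by linarith) (by linarith)).trans ?_
        nlinarith
    · have h1 : 1 ≤ |∑ k, s k ω - v| := by
        rw [abs_of_nonneg (by linarith)]; linarith
      have hpos := Real.exp_pos ((v + 1) / 2)
      have h2 : ‖(Real.exp (v / 2) : ℂ) * f ω‖ ≤ Real.exp ((v + 1) / 2) := by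
        rw [norm_mul, hfn, mul_one, Complex.norm_real, Real.norm_eq_abs, Real.abs_exp]
        exact Real.exp_le_exp.2 (by linarith)
      refine (norm_sub_le _ _).trans ((add_le_add h2 (hgB ω)).trans ?_)
      nlinarith
  have hdiff : ‖(Real.exp (v / 2) : ℂ) * ∫ ω, f ω ∂μ - ∫ ω, g ω ∂μ‖
      ≤ 2 * Real.exp ((v + 1) / 2) * ∫ ω, |∑ k, s k ω - v| ∂μ := by
    rw [← integral_const_mul, ← integral_sub (hfi.const_mul _) hgi, ← integral_const_mul]
    exact norm_integral_le_of_norm_le (hVi.const_mul _) (ae_of_all _ hpt)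
  set R := ∑ k, ∫ ω, (4 * |M k ω| ^ 3 + s k ω ^ 2) ∂μ
  set D := ∫ ω, |∑ k, s k ω - v| ∂μ
  have hD0 : 0 ≤ D := integral_nonneg fun ω => abs_nonneg _
  have hR0 : 0 ≤ R := Finset.sum_nonneg fun k _ => integral_nonneg fun ω => by positivity
  have htot : ‖(Real.exp (v / 2) : ℂ) * ∫ ω, f ω ∂μ - 1‖
      ≤ Real.exp ((v + 1) / 2) * (R + 2 * D) := by
    have : (Real.exp (v / 2) : ℂ) * ∫ ω, f ω ∂μ - 1
        = ((Real.exp (v / 2) : ℂ) * ∫ ω, f ω ∂μ - ∫ ω, g ω ∂μ) + (∫ ω, g ω ∂μ - 1) := by ring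
    rw [this]
    refine (norm_add_le _ _).trans ((add_le_add hdiff
      (htel.trans (mul_le_mul_of_nonneg_left hR (Real.exp_pos _).le))).trans (le_of_eq ?_))
    ring
  have e3 : ∫ ω, f ω ∂μ - (Real.exp (-v / 2) : ℝ)
      = (Real.exp (-v / 2) : ℂ) * ((Real.exp (v / 2) : ℂ) * ∫ ω, f ω ∂μ - 1) := by
    rw [mul_sub, ← mul_assoc, ← Complex.ofReal_mul, ← Real.exp_add]
    have : -v / 2 + v / 2 = 0 := by ring
    simp [this]
  rw [e3, norm_mul, Complex.norm_real, Real.norm_eq_abs, Real.abs_exp]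
  refine (mul_le_mul_of_nonneg_left htot (Real.exp_pos _).le).trans ?_
  rw [← mul_assoc, ← Real.exp_add]
  have e4 : -v / 2 + (v + 1) / 2 = 1 / 2 := by ring
  rw [e4]
  have e5 : Real.exp (1 / 2) ≤ 2 := by
    have h1 := Real.exp_one_lt_d9
    have h2 : Real.exp (1 / 2) * Real.exp (1 / 2) = Real.exp 1 := by
      rw [← Real.exp_add]; norm_num
    nlinarith [Real.exp_pos (1 / 2 : ℝ)]
  exact mul_le_mul_of_nonneg_right e5 (by positivity)

end

/-! ### Integrability and variance of sums and products -/

section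

variable {Ω : Type*} [mΩ : MeasurableSpace Ω] {μ : Measure Ω} [IsProbabilityMeasure μ]

omit [IsProbabilityMeasure μ] in
lemma memLp_two_mul_of_memLp_four {f g : Ω → ℝ} (hf : MemLp f 4 μ) (hg : MemLp g 4 μ) :
    MemLp (fun ω => f ω * g ω) 2 μ := by
  refine (memLp_two_iff_integrable_sq (hf.1.mul hg.1)).2 ?_
  refine Integrable.mono' (hf.integrable_pow_four.add hg.integrable_pow_four)
    ((hf.1.mul hg.1).pow 2) (ae_of_all _ fun ω => ?_)
  simp only [Real.norm_eq_abs, abs_pow, sq_abs, Pi.add_apply, Pi.mul_apply]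
  nlinarith [sq_nonneg (f ω ^ 2 - g ω ^ 2), sq_nonneg (f ω ^ 2), sq_nonneg (g ω ^ 2)]

omit [IsProbabilityMeasure μ] in
lemma memLp_four_of_integrable_pow_four {f : Ω → ℝ} (hf : AEStronglyMeasurable f μ)
    (h : Integrable (fun ω => f ω ^ 4) μ) : MemLp f 4 μ := by
  have := (integrable_norm_rpow_iff (p := 4) hf (by norm_num) (by norm_num)).1 (by
    refine h.congr (ae_of_all _ fun ω => ?_)
    simp only [Real.norm_eq_abs]
    have : (4 : ENNReal).toReal = (4 : ℕ) := by norm_num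
    rw [this, Real.rpow_natCast]
    exact (Even.pow_abs (by decide) _).symm)
  exact this

omit [IsProbabilityMeasure μ] in
lemma memLp_four_mul_of_indepFun {f g : Ω → ℝ} (hfg : IndepFun f g μ) (hf : MemLp f 4 μ)
    (hg : MemLp g 4 μ) : MemLp (fun ω => f ω * g ω) 4 μ := by
  refine memLp_four_of_integrable_pow_four (hf.1.mul hg.1) ?_
  have h4 : IndepFun (fun ω => f ω ^ 4) (fun ω => g ω ^ 4) μ :=
    hfg.comp (φ := fun x : ℝ => x ^ 4) (ψ := fun x : ℝ => x ^ 4) (by fun_prop) (by fun_prop)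
  have := h4.integrable_mul hf.integrable_pow_four hg.integrable_pow_four
  refine this.congr (ae_of_all _ fun ω => ?_)
  simp [mul_pow]

lemma variance_sum_le_card_mul {ι : Type*} (S : Finset ι) {f : ι → Ω → ℝ}
    (hf : ∀ i ∈ S, MemLp (f i) 2 μ) :
    Var[fun ω => ∑ i ∈ S, f i ω; μ] ≤ S.card * ∑ i ∈ S, Var[f i; μ] := by
  have hS : MemLp (fun ω => ∑ i ∈ S, f i ω) 2 μ := memLp_finsetSum S hf
  have hi : ∀ i ∈ S, Integrable (f i) μ := fun i his => (hf i his).integrable (by norm_num)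
  have hint : ∀ i ∈ S, Integrable (fun ω => (f i ω - ∫ ω, f i ω ∂μ) ^ 2) μ := fun i his =>
    ((hf i his).sub (memLp_const _)).integrable_sq
  rw [variance_eq_integral hS.1.aemeasurable, integral_finsetSum S hi]
  calc ∫ ω, (∑ i ∈ S, f i ω - ∑ i ∈ S, ∫ ω, f i ω ∂μ) ^ 2 ∂μ
      ≤ ∫ ω, S.card * ∑ i ∈ S, (f i ω - ∫ ω, f i ω ∂μ) ^ 2 ∂μ := by
        refine integral_mono_of_nonneg (ae_of_all _ fun ω => sq_nonneg _)
          ((integrable_finsetSum S hint).const_mul _) (ae_of_all _ fun ω => ?_)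
        simp only [← Finset.sum_sub_distrib]
        exact sq_sum_le_card_mul_sum_sq
    _ = S.card * ∑ i ∈ S, Var[f i; μ] := by
        rw [integral_const_mul, integral_finsetSum S hint]
        congr 1
        exact Finset.sum_congr rfl fun i his =>
          (variance_eq_integral (hf i his).1.aemeasurable).symm

omit [IsProbabilityMeasure μ] in
lemma integral_sq_sum_of_orthogonal {ι : Type*} (S : Finset ι) {f : ι → Ω → ℝ}
    (hf : ∀ i ∈ S, MemLp (f i) 2 μ)
    (horth : ∀ i ∈ S, ∀ j ∈ S, i ≠ j → ∫ ω, f i ω * f j ω ∂μ = 0) :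
    ∫ ω, (∑ i ∈ S, f i ω) ^ 2 ∂μ = ∑ i ∈ S, ∫ ω, f i ω ^ 2 ∂μ := by
  have hint : ∀ i ∈ S, ∀ j ∈ S, Integrable (fun ω => f i ω * f j ω) μ := fun i hi j hj =>
    (hf i hi).integrable_mul (hf j hj)
  simp_rw [sq, Finset.sum_mul_sum]
  rw [integral_finsetSum S fun i hi => integrable_finsetSum S fun j hj => hint i hi j hj]
  refine Finset.sum_congr rfl fun i hi => ?_
  rw [integral_finsetSum S fun j hj => hint i hi j hj]
  exact Finset.sum_eq_single_of_mem i hi fun j hj hji => horth i hi j hj hji.symm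

lemma integral_abs_sub_integral_le {f : Ω → ℝ} (hf : MemLp f 2 μ) :
    ∫ ω, |f ω - ∫ ω, f ω ∂μ| ∂μ ≤ √(Var[f; μ]) := by
  have h2 : MemLp (fun ω => |f ω - ∫ ω, f ω ∂μ|) 2 μ := (hf.sub (memLp_const _)).abs
  refine Real.le_sqrt_of_sq_le ?_
  have h := variance_nonneg (fun ω => |f ω - ∫ ω, f ω ∂μ|) μ
  rw [variance_eq_sub h2] at h
  have e : ∫ ω, ((fun ω => |f ω - ∫ ω, f ω ∂μ|) ^ 2) ω ∂μ = Var[f; μ] := by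
    rw [variance_eq_integral hf.1.aemeasurable]
    simp
  rw [e] at h
  linarith

end

/-! ### Independent noise and its past -/

section

variable {Ω : Type*} [mΩ : MeasurableSpace Ω] {μ : Measure Ω} [IsProbabilityMeasure μ] {n : ℕ}
  {m : Fin n → MeasurableSpace Ω}

/-- The information carried by the observations with index less than `k`. -/
abbrev past (m : Fin n → MeasurableSpace Ω) (k : ℕ) : MeasurableSpace Ω :=
  ⨆ j ∈ {j : Fin n | (j : ℕ) < k}, m j

omit mΩ in
lemma past_mono : Monotone (past m) := fun _ _ hkl =>
  biSup_mono fun _ hj => lt_of_lt_of_le hj hkl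

lemma past_le (hm : ∀ i, m i ≤ mΩ) (k : ℕ) : past m k ≤ mΩ := iSup₂_le fun j _ => hm j

omit mΩ in
lemma le_past {j : Fin n} {k : ℕ} (h : (j : ℕ) < k) : m j ≤ past m k :=
  le_biSup m (show j ∈ {j : Fin n | (j : ℕ) < k} from h)

omit [IsProbabilityMeasure μ] in
lemma indepFun_of_disjoint (hm : ∀ i, m i ≤ mΩ) (hind : iIndep m μ) {S T : Set (Fin n)}
    (hST : Disjoint S T) {β γ : Type*} [MeasurableSpace β] [MeasurableSpace γ] {f : Ω → β}
    {g : Ω → γ} (hf : Measurable[⨆ i ∈ S, m i] f) (hg : Measurable[⨆ i ∈ T, m i] g) :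
    IndepFun f g μ := by
  rw [IndepFun_iff_Indep]
  exact indep_of_indep_of_le_left (indep_of_indep_of_le_right
    (indep_iSup_of_disjoint hm hind hST) hg.comap_le) hf.comap_le

omit [IsProbabilityMeasure μ] in
lemma indepFun_past (hm : ∀ i, m i ≤ mΩ) (hind : iIndep m μ) (k : Fin n)
    {β γ : Type*} [MeasurableSpace β] [MeasurableSpace γ] {f : Ω → β} {g : Ω → γ}
    (hf : Measurable[past m k] f) (hg : Measurable[m k] g) : IndepFun f g μ := by
  refine indepFun_of_disjoint hm hind (S := {j : Fin n | (j : ℕ) < k}) (T := {k}) ?_ hf ?_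
  · simp
  · have e : ⨆ i ∈ ({k} : Set (Fin n)), m i = m k := by simp
    rw [e]
    exact hg

/-- Centered random variables with uniformly bounded fourth moments, the `i`-th of which is a
function of the `i`-th observation. -/
structure IsNoise (μ : Measure Ω) (m : Fin n → MeasurableSpace Ω) (C : ℝ) (x : Fin n → Ω → ℝ) :
    Prop where
  measurable : ∀ i, Measurable[m i] (x i)
  memLp : ∀ i, MemLp (x i) 4 μ
  mean : ∀ i, ∫ ω, x i ω ∂μ = 0
  moment : ∀ i, ∫ ω, x i ω ^ 4 ∂μ ≤ C

variable {C : ℝ} {x y : Fin n → Ω → ℝ}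

lemma IsNoise.memLp_two (hx : IsNoise μ m C x) (i : Fin n) : MemLp (x i) 2 μ :=
  (hx.memLp i).mono_exponent (by norm_num)

lemma IsNoise.abs_integral_mul_le (hC : 1 ≤ C) (hx : IsNoise μ m C x) (hy : IsNoise μ m C y)
    (i : Fin n) : |∫ ω, x i ω * y i ω ∂μ| ≤ C := by
  have h1 : Integrable (fun ω => (2 + x i ω ^ 4 + y i ω ^ 4) / 4) μ :=
    (((integrable_const _).add (hx.memLp i).integrable_pow_four).add
      (hy.memLp i).integrable_pow_four).div_const 4
  have := norm_integral_le_of_norm_le (f := fun ω => x i ω * y i ω) h1 (ae_of_all _ fun ω => by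
    rw [Real.norm_eq_abs, abs_le]
    constructor <;> nlinarith [sq_nonneg (x i ω + y i ω), sq_nonneg (x i ω - y i ω),
      sq_nonneg (x i ω ^ 2 - 1), sq_nonneg (y i ω ^ 2 - 1)])
  have h2 := integral_add ((integrable_const (2 : ℝ)).add (hx.memLp i).integrable_pow_four)
    (hy.memLp i).integrable_pow_four
  have h3 := integral_add (integrable_const (2 : ℝ)) (hx.memLp i).integrable_pow_four
  simp only [Pi.add_apply] at h2
  rw [integral_div, h2, h3] at this
  simp only [Real.norm_eq_abs, integral_const, probReal_univ, smul_eq_mul, one_mul] at this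
  linarith [hx.moment i, hy.moment i]

lemma IsNoise.integral_sq_le (hC : 1 ≤ C) (hx : IsNoise μ m C x) (i : Fin n) :
    ∫ ω, x i ω ^ 2 ∂μ ≤ C := by
  have := (le_abs_self _).trans (hx.abs_integral_mul_le hC hx i)
  simpa [sq] using this

omit [IsProbabilityMeasure μ] in
lemma IsNoise.integral_mul_past (hm : ∀ i, m i ≤ mΩ) (hind : iIndep m μ) (hx : IsNoise μ m C x)
    {k : Fin n} {f : Ω → ℝ} (hf : Measurable[past m k] f) : ∫ ω, f ω * x k ω ∂μ = 0 := by
  rw [(indepFun_past hm hind k hf (hx.measurable k)).integral_fun_mul_eq_mul_integral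
    (hf.mono (past_le hm _) le_rfl).aestronglyMeasurable (hx.memLp k).1, hx.mean, mul_zero]

omit [IsProbabilityMeasure μ] in
lemma IsNoise.measurable_past (hx : IsNoise μ m C x) {j : Fin n} {k : ℕ} (h : (j : ℕ) < k) :
    Measurable[past m k] (x j) := (hx.measurable j).mono (le_past h) le_rfl

lemma IsNoise.integral_sq_linear_le (hm : ∀ i, m i ≤ mΩ) (hind : iIndep m μ) (hC : 1 ≤ C)
    (hx : IsNoise μ m C x) (S : Finset (Fin n)) (w : Fin n → ℝ) :
    ∫ ω, (∑ j ∈ S, w j * x j ω) ^ 2 ∂μ ≤ C * ∑ j ∈ S, w j ^ 2 := by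
  rw [integral_sq_sum_of_orthogonal S fun i _ => (hx.memLp_two i).const_mul (w i)]
  · rw [Finset.mul_sum]
    refine Finset.sum_le_sum fun j _ => ?_
    simp_rw [mul_pow]
    rw [integral_const_mul, mul_comm]
    exact mul_le_mul_of_nonneg_right (hx.integral_sq_le hC j) (sq_nonneg _)
  · have key : ∀ i j : Fin n, i < j → ∫ ω, w i * x i ω * (w j * x j ω) ∂μ = 0 := fun i j hij => by
      have := hx.integral_mul_past hm hind (k := j) (f := fun ω => w i * w j * x i ω)
        ((hx.measurable_past hij).const_mul _)
      rw [← this]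
      refine integral_congr_ae (ae_of_all _ fun ω => ?_)
      ring
    intro i _ j _ hij
    rcases lt_or_gt_of_ne hij with h | h
    · exact key i j h
    · rw [← key j i h]
      refine integral_congr_ae (ae_of_all _ fun ω => ?_)
      ring

/-- Second moment of a bilinear form in which the second factor is always strictly earlier. -/
lemma IsNoise.integral_sq_strict_le (hm : ∀ i, m i ≤ mΩ) (hind : iIndep m μ) (hC : 1 ≤ C)
    (hx : IsNoise μ m C x) (hy : IsNoise μ m C y) (Γ : Fin n → Fin n → ℝ) :
    (MemLp (fun ω => ∑ j, (∑ l ∈ Finset.Iio j, Γ j l * y l ω) * x j ω) 2 μ) ∧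
    ∫ ω, (∑ j, (∑ l ∈ Finset.Iio j, Γ j l * y l ω) * x j ω) ∂μ = 0 ∧
    ∫ ω, (∑ j, (∑ l ∈ Finset.Iio j, Γ j l * y l ω) * x j ω) ^ 2 ∂μ
      ≤ C ^ 2 * ∑ j, ∑ l ∈ Finset.Iio j, Γ j l ^ 2 := by
  have hYm : ∀ j : Fin n, Measurable[past m j] (fun ω => ∑ l ∈ Finset.Iio j, Γ j l * y l ω) :=
    fun j => Finset.measurable_fun_sum _ fun l hl =>
      (hy.measurable_past (Fin.lt_def.1 (Finset.mem_Iio.1 hl))).const_mul _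
  have hY4 : ∀ j : Fin n, MemLp (fun ω => ∑ l ∈ Finset.Iio j, Γ j l * y l ω) 4 μ := fun j =>
    memLp_finsetSum _ fun l _ => (hy.memLp l).const_mul _
  have hD : ∀ j, MemLp (fun ω => (∑ l ∈ Finset.Iio j, Γ j l * y l ω) * x j ω) 2 μ := fun j =>
    memLp_two_mul_of_memLp_four (hY4 j) (hx.memLp j)
  refine ⟨memLp_finsetSum _ fun j _ => hD j, ?_, ?_⟩
  · rw [integral_finsetSum _ fun j _ => (hD j).integrable (by norm_num)]
    exact Finset.sum_eq_zero fun j _ => hx.integral_mul_past hm hind (hYm j)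
  rw [integral_sq_sum_of_orthogonal _ fun j _ => hD j]
  · rw [Finset.mul_sum]
    refine Finset.sum_le_sum fun j _ => ?_
    have hi : IndepFun (fun ω => (∑ l ∈ Finset.Iio j, Γ j l * y l ω) ^ 2) (fun ω => x j ω ^ 2) μ :=
      (indepFun_past hm hind j (hYm j) (hx.measurable j)).comp (φ := fun x : ℝ => x ^ 2)
        (ψ := fun x : ℝ => x ^ 2) (by fun_prop) (by fun_prop)
    simp_rw [mul_pow]
    rw [hi.integral_fun_mul_eq_mul_integral ((hY4 j).1.pow 2) ((hx.memLp j).1.pow 2), sq C, mul_assoc,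
      mul_comm]
    exact mul_le_mul (hx.integral_sq_le hC j) (hy.integral_sq_linear_le hm hind hC _ _)
      (integral_nonneg fun _ => sq_nonneg _) (by linarith)
  · have key : ∀ i j : Fin n, i < j → ∫ ω, ((∑ l ∈ Finset.Iio i, Γ i l * y l ω) * x i ω)
        * ((∑ l ∈ Finset.Iio j, Γ j l * y l ω) * x j ω) ∂μ = 0 := fun i j hij => by
      have h1 : Measurable[past m j] (fun ω => ∑ l ∈ Finset.Iio i, Γ i l * y l ω) :=
        (hYm i).mono (past_mono hij.le) le_rfl
      have := hx.integral_mul_past hm hind (k := j)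
        ((h1.mul (hx.measurable_past hij)).mul (hYm j))
      rw [← this]
      refine integral_congr_ae (ae_of_all _ fun ω => ?_)
      simp only [Pi.mul_apply]
      ring
    intro i _ j _ hij
    rcases lt_or_gt_of_ne hij with h | h
    · exact key i j h
    · rw [← key j i h]
      refine integral_congr_ae (ae_of_all _ fun ω => ?_)
      ring

/-- Quadratic forms in independent noise have variance of the order of the squared Frobenius norm of
the coefficients: the strictly lower and the strictly upper triangular parts are martingales and
the diagonal part is a sum of independent terms. -/
lemma IsNoise.variance_bilinear_le (hm : ∀ i, m i ≤ mΩ) (hind : iIndep m μ) (hC : 1 ≤ C)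
    (hx : IsNoise μ m C x) (hy : IsNoise μ m C y) (Γ : Fin n → Fin n → ℝ) :
    Var[fun ω => ∑ j, ∑ l, Γ j l * x j ω * y l ω; μ] ≤ 9 * C ^ 2 * ∑ j, ∑ l, Γ j l ^ 2 := by
  obtain ⟨l1, l2, l3⟩ := hx.integral_sq_strict_le hm hind hC hy Γ
  obtain ⟨u1, u2, u3⟩ := hy.integral_sq_strict_le hm hind hC hx (fun j l => Γ l j)
  have hxy : ∀ j, MemLp (fun ω => x j ω * y j ω) 2 μ := fun j =>
    memLp_two_mul_of_memLp_four (hx.memLp j) (hy.memLp j)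
  have d1 : MemLp (fun ω => ∑ j, Γ j j * (x j ω * y j ω)) 2 μ :=
    memLp_finsetSum _ fun j _ => (hxy j).const_mul _
  have d2 : Var[fun ω => ∑ j, Γ j j * (x j ω * y j ω); μ] ≤ C ^ 2 * ∑ j, Γ j j ^ 2 := by
    have := IndepFun.variance_sum (μ := μ) (s := Finset.univ)
      (X := fun (j : Fin n) ω => Γ j j * (x j ω * y j ω)) (fun j _ => (hxy j).const_mul _)
      (fun i _ j _ hij => by
        refine indepFun_of_disjoint hm hind (S := {i}) (T := {j}) (by simpa using hij) ?_ ?_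
        · have e : ⨆ k ∈ ({i} : Set (Fin n)), m k = m i := by simp
          rw [e]
          exact ((hx.measurable i).mul (hy.measurable i)).const_mul _
        · have e : ⨆ k ∈ ({j} : Set (Fin n)), m k = m j := by simp
          rw [e]
          exact ((hx.measurable j).mul (hy.measurable j)).const_mul _)
    have e : (∑ j : Fin n, fun ω => Γ j j * (x j ω * y j ω))
        = fun ω => ∑ j, Γ j j * (x j ω * y j ω) := by
      ext ω; simp
    rw [e] at this
    rw [this, Finset.mul_sum]
    refine Finset.sum_le_sum fun j _ => ?_
    rw [variance_const_mul, mul_comm]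
    refine mul_le_mul_of_nonneg_right ?_ (sq_nonneg _)
    refine (variance_le_expectation_sq (hxy j).1).trans ?_
    have hi : ∫ ω, ((fun ω => x j ω * y j ω) ^ 2) ω ∂μ
        ≤ ∫ ω, (x j ω ^ 4 + y j ω ^ 4) / 2 ∂μ := by
      refine integral_mono (hxy j).integrable_sq
        (((hx.memLp j).integrable_pow_four.add (hy.memLp j).integrable_pow_four).div_const 2)
        fun ω => ?_
      simp only [Pi.pow_apply]
      nlinarith [sq_nonneg (x j ω ^ 2 - y j ω ^ 2)]
    rw [integral_div, integral_add (hx.memLp j).integrable_pow_four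
      (hy.memLp j).integrable_pow_four] at hi
    nlinarith [hx.moment j, hy.moment j]
  set F : Fin 3 → Ω → ℝ := ![fun ω => ∑ j, (∑ l ∈ Finset.Iio j, Γ j l * y l ω) * x j ω,
    fun ω => ∑ j, (∑ l ∈ Finset.Iio j, Γ l j * x l ω) * y j ω,
    fun ω => ∑ j, Γ j j * (x j ω * y j ω)] with hF
  have hF2 : ∀ i ∈ Finset.univ, MemLp (F i) 2 μ := fun i _ => by
    fin_cases i
    · exact l1
    · exact u1
    · exact d1
  have split : ∀ g : Fin n → Fin n → ℝ, ∑ j, ∑ l, g j l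
      = ∑ j, ∑ l ∈ Finset.Iio j, g j l + ∑ j, ∑ l ∈ Finset.Iio j, g l j + ∑ j, g j j := fun g => by
    have h1 : ∑ j, ∑ l ∈ Finset.Iio j, g l j = ∑ j, ∑ l ∈ Finset.Ioi j, g j l := by
      refine Finset.sum_comm' fun a b => ?_
      simp
    rw [h1, ← Finset.sum_add_distrib, ← Finset.sum_add_distrib]
    refine Finset.sum_congr rfl fun j _ => ?_
    have h2 : (Finset.univ : Finset (Fin n)) = (Finset.Iio j ∪ Finset.Ioi j) ∪ {j} := by
      ext a
      simp only [Finset.mem_univ, Finset.mem_union, Finset.mem_Iio, Finset.mem_Ioi,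
        Finset.mem_singleton, true_iff]
      rcases lt_trichotomy a j with h | h | h <;> simp [h]
    rw [h2, Finset.sum_union, Finset.sum_union, Finset.sum_singleton]
    · rw [Finset.disjoint_left]
      intro a ha hb
      exact absurd (Finset.mem_Iio.1 ha) (not_lt.2 (Finset.mem_Ioi.1 hb).le)
    · simp
  have e : (fun ω => ∑ j, ∑ l, Γ j l * x j ω * y l ω) = fun ω => ∑ i, F i ω := by
    ext ω
    rw [split (fun j l => Γ j l * x j ω * y l ω), Fin.sum_univ_three]
    simp only [hF, Matrix.cons_val_zero, Matrix.cons_val_one, Matrix.cons_val, Finset.sum_mul]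
    congr 1
    · congr 1
      · exact Finset.sum_congr rfl fun j _ => Finset.sum_congr rfl fun l _ => by ring
    · exact Finset.sum_congr rfl fun j _ => by ring
  have v0 : Var[F 0; μ] ≤ C ^ 2 * ∑ j, ∑ l ∈ Finset.Iio j, Γ j l ^ 2 :=
    (variance_le_expectation_sq l1.1).trans l3
  have v1 : Var[F 1; μ] ≤ C ^ 2 * ∑ j, ∑ l ∈ Finset.Iio j, Γ l j ^ 2 :=
    (variance_le_expectation_sq u1.1).trans u3
  have v2 : Var[F 2; μ] ≤ C ^ 2 * ∑ j, Γ j j ^ 2 := d2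
  rw [e]
  refine (variance_sum_le_card_mul _ hF2).trans ?_
  rw [Fin.sum_univ_three, split (fun j l => Γ j l ^ 2)]
  have hC2 : 0 ≤ C ^ 2 := sq_nonneg C
  have p0 : 0 ≤ ∑ j, ∑ l ∈ Finset.Iio j, Γ j l ^ 2 :=
    Finset.sum_nonneg fun _ _ => Finset.sum_nonneg fun _ _ => sq_nonneg _
  have p1 : 0 ≤ ∑ j, ∑ l ∈ Finset.Iio j, Γ l j ^ 2 :=
    Finset.sum_nonneg fun _ _ => Finset.sum_nonneg fun _ _ => sq_nonneg _
  have p2 : 0 ≤ ∑ j, Γ j j ^ 2 := Finset.sum_nonneg fun _ _ => sq_nonneg _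
  simp only [Finset.card_univ, Fintype.card_fin, Nat.cast_ofNat]
  nlinarith [mul_nonneg hC2 p0, mul_nonneg hC2 p1, mul_nonneg hC2 p2]

omit [IsProbabilityMeasure μ] in
lemma IsNoise.memLp_linear (hx : IsNoise μ m C x) (w : Fin n → ℝ) :
    MemLp (fun ω => ∑ j, w j * x j ω) 4 μ := memLp_finsetSum _ fun j _ => (hx.memLp j).const_mul _

lemma IsNoise.integral_pow_four_linear_le (hm : ∀ i, m i ≤ mΩ) (hind : iIndep m μ) (hC : 1 ≤ C)
    (hx : IsNoise μ m C x) (w : Fin n → ℝ) :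
    ∫ ω, (∑ j, w j * x j ω) ^ 4 ∂μ ≤ 10 * C ^ 2 * (∑ j, w j ^ 2) ^ 2 := by
  have h4 := hx.memLp_linear w
  have h2 : MemLp (fun ω => (∑ j, w j * x j ω) ^ 2) 2 μ := by
    simpa [sq] using memLp_two_mul_of_memLp_four h4 h4
  have hv := hx.variance_bilinear_le hm hind hC hx (fun j l => w j * w l)
  have e1 : (fun ω => ∑ j, ∑ l, w j * w l * x j ω * x l ω)
      = fun ω => (∑ j, w j * x j ω) ^ 2 := by
    ext ω
    rw [sq, Finset.sum_mul_sum]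
    exact Finset.sum_congr rfl fun j _ => Finset.sum_congr rfl fun l _ => by ring
  have e2 : ∑ j, ∑ l, (w j * w l) ^ 2 = (∑ j, w j ^ 2) ^ 2 := by
    rw [sq (∑ j, w j ^ 2), Finset.sum_mul_sum]
    exact Finset.sum_congr rfl fun j _ => Finset.sum_congr rfl fun l _ => by ring
  rw [e1, e2, variance_eq_sub h2] at hv
  have e3 : ∫ ω, ((fun ω => (∑ j, w j * x j ω) ^ 2) ^ 2) ω ∂μ
      = ∫ ω, (∑ j, w j * x j ω) ^ 4 ∂μ := by
    refine integral_congr_ae (ae_of_all _ fun ω => ?_)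
    simp only [Pi.pow_apply]
    ring
  rw [e3] at hv
  have h3 := hx.integral_sq_linear_le hm hind hC Finset.univ w
  have h0 : 0 ≤ ∫ ω, (∑ j, w j * x j ω) ^ 2 ∂μ := integral_nonneg fun _ => sq_nonneg _
  nlinarith [mul_le_mul h3 h3 h0 (h0.trans h3)]

end

/-! ### Gram matrices -/

section

variable {n : ℕ}

/-- The squared Frobenius norm of `Q Qᵀ`. -/
def gramSq (Q : Matrix (Fin n) (Fin n) ℝ) : ℝ := ∑ k, ∑ l, (Q * Qᵀ) k l ^ 2

lemma gramSq_nonneg (Q : Matrix (Fin n) (Fin n) ℝ) : 0 ≤ gramSq Q :=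
  Finset.sum_nonneg fun _ _ => Finset.sum_nonneg fun _ _ => sq_nonneg _

lemma mul_transpose_self_apply (Q : Matrix (Fin n) (Fin n) ℝ) (k l : Fin n) :
    (Q * Qᵀ) k l = ∑ j, Q k j * Q l j := by
  simp [Matrix.mul_apply]

lemma sum_sq_rowSq_le_gramSq (Q : Matrix (Fin n) (Fin n) ℝ) :
    ∑ k, (∑ j, Q k j ^ 2) ^ 2 ≤ gramSq Q := by
  refine Finset.sum_le_sum fun k _ => ?_
  have : ∑ j, Q k j ^ 2 = (Q * Qᵀ) k k := by
    rw [mul_transpose_self_apply]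
    exact Finset.sum_congr rfl fun j _ => sq _
  rw [this]
  exact Finset.single_le_sum (f := fun l => (Q * Qᵀ) k l ^ 2) (fun _ _ => sq_nonneg _)
    (Finset.mem_univ k)

lemma sum_sq_weighted_col_le (Q : Matrix (Fin n) (Fin n) ℝ) (w : Fin n → ℝ) :
    ∑ j, (∑ k, w k * Q k j) ^ 2 ≤ √(gramSq Q) * ∑ k, w k ^ 2 := by
  have e : ∑ j, (∑ k, w k * Q k j) ^ 2
      = ∑ p : Fin n × Fin n, (w p.1 * w p.2) * (Q * Qᵀ) p.1 p.2 := by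
    simp_rw [sq, Finset.sum_mul_sum, mul_transpose_self_apply, Finset.mul_sum]
    rw [Fintype.sum_prod_type, Finset.sum_comm]
    refine Finset.sum_congr rfl fun k _ => ?_
    rw [Finset.sum_comm]
    exact Finset.sum_congr rfl fun l _ => Finset.sum_congr rfl fun j _ => by ring
  have h1 := Finset.sum_mul_sq_le_sq_mul_sq (Finset.univ : Finset (Fin n × Fin n))
    (fun p => w p.1 * w p.2) (fun p => (Q * Qᵀ) p.1 p.2)
  have h2 : ∑ p : Fin n × Fin n, (w p.1 * w p.2) ^ 2 = (∑ k, w k ^ 2) ^ 2 := by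
    rw [Fintype.sum_prod_type, sq (∑ k, w k ^ 2), Finset.sum_mul_sum]
    exact Finset.sum_congr rfl fun j _ => Finset.sum_congr rfl fun l _ => by ring
  have h3 : ∑ p : Fin n × Fin n, (Q * Qᵀ) p.1 p.2 ^ 2 = gramSq Q := by
    rw [Fintype.sum_prod_type]; rfl
  rw [h2, h3, ← e] at h1
  have h0 : 0 ≤ ∑ k, w k ^ 2 := Finset.sum_nonneg fun _ _ => sq_nonneg _
  refine (sq_le_sq₀ (Finset.sum_nonneg fun _ _ => sq_nonneg _) (by positivity)).1 ?_
  rw [mul_pow, Real.sq_sqrt (gramSq_nonneg Q), mul_comm]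
  exact h1

lemma sum_sq_sandwich_le (Q R : Matrix (Fin n) (Fin n) ℝ) {d : Fin n → ℝ} {C τ : ℝ}
    (hd : ∀ k, |d k| ≤ C) (hQ : gramSq Q ≤ τ) (hR : gramSq R ≤ τ) :
    ∑ j, ∑ l, (∑ k, d k * Q k j * R k l) ^ 2 ≤ C ^ 2 * τ := by
  have e : ∑ j, ∑ l, (∑ k, d k * Q k j * R k l) ^ 2
      = ∑ k, ∑ k', (d k * d k') * ((Q * Qᵀ) k k' * (R * Rᵀ) k k') := by
    simp_rw [sq, Finset.sum_mul_sum, mul_transpose_self_apply, Finset.sum_mul_sum, Finset.mul_sum]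
    calc _ = ∑ j, ∑ k, ∑ k', ∑ l, d k * Q k j * R k l * (d k' * Q k' j * R k' l) := by
          refine Finset.sum_congr rfl fun j _ => ?_
          rw [Finset.sum_comm]
          refine Finset.sum_congr rfl fun k _ => ?_
          rw [Finset.sum_comm]
      _ = _ := by
          rw [Finset.sum_comm]
          refine Finset.sum_congr rfl fun k _ => ?_
          rw [Finset.sum_comm]
          exact Finset.sum_congr rfl fun k' _ => Finset.sum_congr rfl fun j _ =>
            Finset.sum_congr rfl fun l _ => by ring
  rw [e]
  calc _ ≤ ∑ k, ∑ k', C ^ 2 * (((Q * Qᵀ) k k' ^ 2 + (R * Rᵀ) k k' ^ 2) / 2) := by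
        refine Finset.sum_le_sum fun k _ => Finset.sum_le_sum fun k' _ => ?_
        refine (le_abs_self _).trans ?_
        rw [abs_mul, abs_mul]
        have hC : 0 ≤ C := (abs_nonneg _).trans (hd k)
        have h1 : |d k| * |d k'| ≤ C ^ 2 := by
          rw [sq]; exact mul_le_mul (hd k) (hd k') (abs_nonneg _) hC
        refine mul_le_mul h1 ?_ (abs_nonneg _) (sq_nonneg _)
        rw [abs_le]
        constructor <;> nlinarith [sq_nonneg ((Q * Qᵀ) k k' - (R * Rᵀ) k k'),
          sq_nonneg ((Q * Qᵀ) k k' + (R * Rᵀ) k k')]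
    _ = C ^ 2 * ((gramSq Q + gramSq R) / 2) := by
        simp_rw [← Finset.mul_sum, ← Finset.sum_div, Finset.sum_add_distrib]
        rfl
    _ ≤ C ^ 2 * τ := mul_le_mul_of_nonneg_left (by linarith) (sq_nonneg _)

end

/-! ### Second-order chaos as a martingale -/

section

variable {Ω : Type*} [mΩ : MeasurableSpace Ω] {μ : Measure Ω} [IsProbabilityMeasure μ] {n : ℕ}
  {m : Fin n → MeasurableSpace Ω} {C : ℝ} {A : Fin 2 → Fin n → ℝ}
  {Q : Fin 2 → Fin 2 → Matrix (Fin n) (Fin n) ℝ} {x : Fin 2 → Fin n → Ω → ℝ}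

/-- The predictable coefficient of the noise `x a k`: an intercept plus linear forms in the noise,
with `Q a c` strictly lower triangular in the applications. -/
def predCoef (A : Fin 2 → Fin n → ℝ) (Q : Fin 2 → Fin 2 → Matrix (Fin n) (Fin n) ℝ)
    (x : Fin 2 → Fin n → Ω → ℝ) (a : Fin 2) (k : Fin n) (ω : Ω) : ℝ :=
  A a k + ∑ c, ∑ j, Q a c k j * x c j ω

/-- The `k`-th martingale difference of the second-order chaos with coefficients `A` and `Q`. -/
def chaosDiff (A : Fin 2 → Fin n → ℝ) (Q : Fin 2 → Fin 2 → Matrix (Fin n) (Fin n) ℝ)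
    (x : Fin 2 → Fin n → Ω → ℝ) (k : Fin n) (ω : Ω) : ℝ :=
  ∑ a, predCoef A Q x a k ω * x a k ω

/-- The conditional variance of `chaosDiff` given the past. -/
noncomputable def chaosVar (μ : Measure Ω) (A : Fin 2 → Fin n → ℝ) (Q : Fin 2 → Fin 2 → Matrix (Fin n) (Fin n) ℝ)
    (x : Fin 2 → Fin n → Ω → ℝ) (k : Fin n) (ω : Ω) : ℝ :=
  ∑ a, ∑ b, (∫ ω', x a k ω' * x b k ω' ∂μ) * (predCoef A Q x a k ω * predCoef A Q x b k ω)

omit [IsProbabilityMeasure μ] in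
lemma measurable_predCoef (hx : ∀ a, IsNoise μ m C (x a))
    (hQ : ∀ a c k j, ¬ j < k → Q a c k j = 0) (a : Fin 2) (k : Fin n) :
    Measurable[past m k] (predCoef A Q x a k) := by
  refine Measurable.add (@measurable_const _ _ _ (past m k) _)
    (Finset.measurable_fun_sum _ fun c _ => Finset.measurable_fun_sum _ fun j _ => ?_)
  by_cases h : j < k
  · exact ((hx c).measurable_past (Fin.lt_def.1 h)).const_mul _
  · simp only [hQ a c k j h, zero_mul]
    exact @measurable_const _ _ _ (past m k) _

lemma memLp_predCoef (hx : ∀ a, IsNoise μ m C (x a)) (a : Fin 2) (k : Fin n) :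
    MemLp (predCoef A Q x a k) 4 μ := by
  have h : MemLp (fun ω => ∑ c, ∑ j, Q a c k j * x c j ω) 4 μ :=
    memLp_finsetSum _ fun c _ => (hx c).memLp_linear _
  have e : predCoef A Q x a k = (fun _ => A a k) + fun ω => ∑ c, ∑ j, Q a c k j * x c j ω := rfl
  rw [e]
  exact (memLp_const (A a k)).add h

lemma isMartingaleDiff_chaos (hm : ∀ i, m i ≤ mΩ) (hind : iIndep m μ)
    (hx : ∀ a, IsNoise μ m C (x a)) (hQ : ∀ a c k j, ¬ j < k → Q a c k j = 0) :
    IsMartingaleDiff μ (past m) (chaosDiff A Q x) (chaosVar μ A Q x) := by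
  have hp := fun a k => measurable_predCoef (A := A) hx hQ a k
  have hp4 := fun a k => memLp_predCoef (A := A) (Q := Q) hx a k
  have hbdd : ∀ {W : Ω → ℂ} {c : ℝ} {k : ℕ}, Measurable[past m k] W → (∀ ω, ‖W ω‖ ≤ c) →
      ∀ {g : Ω → ℝ}, Integrable g μ → Integrable (fun ω => W ω * (g ω : ℂ)) μ :=
    fun hW hc _ hg => hg.ofReal.bdd_mul (hW.mono (past_le hm _) le_rfl).aestronglyMeasurable
      (ae_of_all _ hc)
  have hprod : ∀ {W : Ω → ℂ} {k : Fin n} {f g : Ω → ℝ}, Measurable[past m k] W →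
      Measurable[past m k] f → Measurable[m k] g →
      ∫ ω, W ω * ((f ω * g ω : ℝ) : ℂ) ∂μ = (∫ ω, W ω * (f ω : ℂ) ∂μ) * ((∫ ω, g ω ∂μ : ℝ) : ℂ) :=
    fun {W k f g} hW hf hg => by
      have h1 : Measurable[past m k] (fun ω => W ω * (f ω : ℂ)) :=
        hW.mul (Complex.measurable_ofReal.comp hf)
      have h2 : Measurable[m k] (fun ω => (g ω : ℂ)) := Complex.measurable_ofReal.comp hg
      have := (indepFun_past hm hind k h1 h2).integral_fun_mul_eq_mul_integral
        (h1.mono (past_le hm _) le_rfl).aestronglyMeasurable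
        (h2.mono (hm k) le_rfl).aestronglyMeasurable
      rw [integral_complex_ofReal] at this
      rw [← this]
      refine integral_congr_ae (ae_of_all _ fun ω => ?_)
      simp only [Complex.ofReal_mul]
      ring
  refine ⟨fun k => ?_, fun k => ?_, fun k ω => ?_, fun k => ?_, fun k => ?_, ?_, ?_⟩
  · exact Finset.measurable_fun_sum _ fun a _ =>
      ((hp a k).mono (past_mono (Nat.le_succ _)) le_rfl).mul
        ((hx a).measurable_past (Nat.lt_succ_self _))
  · exact Finset.measurable_fun_sum _ fun a _ => Finset.measurable_fun_sum _ fun b _ =>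
      ((hp a k).mul (hp b k)).const_mul _
  · -- the conditional variance is the second moment of a linear form in `x 0 k` and `x 1 k`
    have e : chaosVar μ A Q x k ω = ∫ ω', (∑ a, predCoef A Q x a k ω * x a k ω') ^ 2 ∂μ := by
      have hi : ∀ a b, Integrable (fun ω' => x a k ω' * x b k ω') μ := fun a b =>
        ((hx a).memLp_two k).integrable_mul ((hx b).memLp_two k)
      simp_rw [sq, Finset.sum_mul_sum]
      have e1 : ∀ a b ω', predCoef A Q x a k ω * x a k ω' * (predCoef A Q x b k ω * x b k ω')
          = predCoef A Q x a k ω * predCoef A Q x b k ω * (x a k ω' * x b k ω') :=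
        fun a b ω' => by ring
      simp_rw [e1]
      rw [integral_finsetSum _ fun a _ => integrable_finsetSum _ fun b _ => (hi a b).const_mul _]
      refine Finset.sum_congr rfl fun a _ => ?_
      rw [integral_finsetSum _ fun b _ => (hi a b).const_mul _]
      refine Finset.sum_congr rfl fun b _ => ?_
      rw [integral_const_mul, mul_comm]
    rw [e]
    exact integral_nonneg fun _ => sq_nonneg _
  · exact memLp_finsetSum _ fun a _ => memLp_four_mul_of_indepFun
      (indepFun_past hm hind k (hp a k) ((hx a).measurable k)) (hp4 a k) ((hx a).memLp k)
  · exact memLp_finsetSum _ fun a _ => memLp_finsetSum _ fun b _ =>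
      (memLp_two_mul_of_memLp_four (hp4 a k) (hp4 b k)).const_mul _
  · intro k W c hW hc
    simp only [chaosDiff, Complex.ofReal_sum, Finset.mul_sum]
    have hi : ∀ a, Integrable (fun ω => predCoef A Q x a k ω * x a k ω) μ := fun a =>
      (memLp_two_mul_of_memLp_four (hp4 a k) ((hx a).memLp k)).integrable (by norm_num)
    rw [integral_finsetSum _ fun a _ => hbdd hW hc (hi a)]
    refine Finset.sum_eq_zero fun a _ => ?_
    rw [hprod hW (hp a k) ((hx a).measurable k), (hx a).mean]
    simp
  · intro k W c hW hc
    have hpx : ∀ a, MemLp (fun ω => predCoef A Q x a k ω * x a k ω) 4 μ := fun a =>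
      memLp_four_mul_of_indepFun
        (indepFun_past hm hind k (hp a k) ((hx a).measurable k)) (hp4 a k) ((hx a).memLp k)
    have hi1 : ∀ a b, Integrable (fun ω => (predCoef A Q x a k ω * predCoef A Q x b k ω)
        * (x a k ω * x b k ω)) μ := fun a b => by
      refine ((memLp_two_mul_of_memLp_four (hpx a) (hpx b)).integrable (by norm_num)).congr
        (ae_of_all _ fun ω => ?_)
      simp only
      ring
    have hi2 : ∀ a b, Integrable (fun ω => (predCoef A Q x a k ω * predCoef A Q x b k ω)
        * ∫ ω', x a k ω' * x b k ω' ∂μ) μ := fun a b =>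
      ((memLp_two_mul_of_memLp_four (hp4 a k) (hp4 b k)).integrable (by norm_num)).mul_const _
    have e : ∀ ω, W ω * ((chaosDiff A Q x k ω : ℂ) ^ 2 - chaosVar μ A Q x k ω)
        = ∑ a, ∑ b, (W ω * (((predCoef A Q x a k ω * predCoef A Q x b k ω)
            * (x a k ω * x b k ω) : ℝ) : ℂ)
          - W ω * (((predCoef A Q x a k ω * predCoef A Q x b k ω)
            * ∫ ω', x a k ω' * x b k ω' ∂μ : ℝ) : ℂ)) := fun ω => by
      rw [← Complex.ofReal_pow, ← Complex.ofReal_sub]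
      simp_rw [← mul_sub, ← Complex.ofReal_sub, ← Finset.mul_sum, ← Complex.ofReal_sum]
      congr 2
      simp only [chaosDiff, chaosVar]
      rw [sq, Finset.sum_mul_sum, ← Finset.sum_sub_distrib]
      refine Finset.sum_congr rfl fun a _ => ?_
      rw [← Finset.sum_sub_distrib]
      exact Finset.sum_congr rfl fun b _ => by ring
    simp_rw [e]
    have hsub : ∀ a b, Integrable (fun ω =>
        W ω * (((predCoef A Q x a k ω * predCoef A Q x b k ω) * (x a k ω * x b k ω) : ℝ) : ℂ)
          - W ω * (((predCoef A Q x a k ω * predCoef A Q x b k ω)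
            * ∫ ω', x a k ω' * x b k ω' ∂μ : ℝ) : ℂ)) μ := fun a b =>
      (hbdd hW hc (hi1 a b)).sub (hbdd hW hc (hi2 a b))
    rw [integral_finsetSum _ fun a _ => integrable_finsetSum _ fun b _ => hsub a b]
    refine Finset.sum_eq_zero fun a _ => ?_
    rw [integral_finsetSum _ fun b _ => hsub a b]
    refine Finset.sum_eq_zero fun b _ => ?_
    rw [integral_sub (hbdd hW hc (hi1 a b)) (hbdd hW hc (hi2 a b)),
      hprod (f := fun ω => predCoef A Q x a k ω * predCoef A Q x b k ω)
        (g := fun ω => x a k ω * x b k ω) hW ((hp a k).mul (hp b k)) (((hx a).measurable k).mul ((hx b).measurable k))]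
    simp only [Complex.ofReal_mul, ← mul_assoc]
    rw [integral_mul_const]
    simp

end

/-! ### Moment bounds and the quantitative central limit theorem -/

section

variable {Ω : Type*} [mΩ : MeasurableSpace Ω] {μ : Measure Ω} [IsProbabilityMeasure μ] {n : ℕ}
  {m : Fin n → MeasurableSpace Ω} {C τ : ℝ} {A : Fin 2 → Fin n → ℝ}
  {Q : Fin 2 → Fin 2 → Matrix (Fin n) (Fin n) ℝ} {x : Fin 2 → Fin n → Ω → ℝ}

lemma sum_integral_predCoef_pow_four_le (hm : ∀ i, m i ≤ mΩ) (hind : iIndep m μ) (hC : 1 ≤ C)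
    (hx : ∀ a, IsNoise μ m C (x a)) (hτ : ∀ a c, gramSq (Q a c) ≤ τ) (a : Fin 2) :
    ∑ k, ∫ ω, predCoef A Q x a k ω ^ 4 ∂μ ≤ 27 * (∑ k, A a k ^ 4 + 20 * C ^ 2 * τ) := by
  have hlin : ∀ c k, Integrable (fun ω => (∑ j, Q a c k j * x c j ω) ^ 4) μ := fun c k =>
    ((hx c).memLp_linear _).integrable_pow_four
  have hk : ∀ k, ∫ ω, predCoef A Q x a k ω ^ 4 ∂μ
      ≤ 27 * (A a k ^ 4 + ∑ c, 10 * C ^ 2 * (∑ j, Q a c k j ^ 2) ^ 2) := fun k => by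
    have hi : Integrable (fun ω => 27 * (A a k ^ 4 + ∑ c, (∑ j, Q a c k j * x c j ω) ^ 4)) μ :=
      ((integrable_const _).add (integrable_finsetSum _ fun c _ => hlin c k)).const_mul 27
    have h1 : ∫ ω, predCoef A Q x a k ω ^ 4 ∂μ
        ≤ ∫ ω, 27 * (A a k ^ 4 + ∑ c, (∑ j, Q a c k j * x c j ω) ^ 4) ∂μ := by
      refine integral_mono (memLp_predCoef hx a k).integrable_pow_four hi fun ω => ?_
      simp only [predCoef, Fin.sum_univ_two]
      generalize A a k = p
      generalize ∑ j, Q a 0 k j * x 0 j ω = q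
      generalize ∑ j, Q a 1 k j * x 1 j ω = r
      have h2 : (p + (q + r)) ^ 2 ≤ 3 * (p ^ 2 + q ^ 2 + r ^ 2) := by
        nlinarith [sq_nonneg (p - q), sq_nonneg (p - r), sq_nonneg (q - r)]
      have h3 : (p ^ 2 + q ^ 2 + r ^ 2) ^ 2 ≤ 3 * (p ^ 4 + q ^ 4 + r ^ 4) := by
        nlinarith [sq_nonneg (p ^ 2 - q ^ 2), sq_nonneg (p ^ 2 - r ^ 2), sq_nonneg (q ^ 2 - r ^ 2)]
      have h4 : ((p + (q + r)) ^ 2) ^ 2 ≤ (3 * (p ^ 2 + q ^ 2 + r ^ 2)) ^ 2 :=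
        pow_le_pow_left₀ (sq_nonneg _) h2 2
      nlinarith
    refine h1.trans ?_
    have h5 := integral_add (integrable_const (μ := μ) (A a k ^ 4))
      (integrable_finsetSum Finset.univ fun c _ => hlin c k)
    rw [integral_const_mul, h5, integral_finsetSum _ fun c _ => hlin c k]
    simp only [integral_const, probReal_univ, smul_eq_mul, one_mul]
    have := Finset.sum_le_sum fun c (_ : c ∈ Finset.univ) =>
      (hx c).integral_pow_four_linear_le hm hind hC (fun j => Q a c k j)
    linarith
  refine (Finset.sum_le_sum fun k _ => hk k).trans ?_
  rw [← Finset.mul_sum, Finset.sum_add_distrib, Finset.sum_comm]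
  have h6 : ∀ c, ∑ k, 10 * C ^ 2 * (∑ j, Q a c k j ^ 2) ^ 2 ≤ 10 * C ^ 2 * τ := fun c => by
    rw [← Finset.mul_sum]
    exact mul_le_mul_of_nonneg_left ((sum_sq_rowSq_le_gramSq _).trans (hτ a c)) (by positivity)
  have h7 := Finset.sum_le_sum fun c (_ : c ∈ Finset.univ) => h6 c
  simp only [Fin.sum_univ_two] at h7 ⊢
  linarith

lemma sum_integral_chaosDiff_pow_four_le (hm : ∀ i, m i ≤ mΩ) (hind : iIndep m μ) (hC : 1 ≤ C)
    (hx : ∀ a, IsNoise μ m C (x a)) (hQ : ∀ a c k j, ¬ j < k → Q a c k j = 0)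
    (hτ : ∀ a c, gramSq (Q a c) ≤ τ) :
    ∑ k, ∫ ω, chaosDiff A Q x k ω ^ 4 ∂μ
      ≤ 216 * C ^ 2 * (∑ a, ∑ k, A a k ^ 4 + 40 * C ^ 2 * τ) := by
  have hp4 := fun a k => memLp_predCoef (A := A) (Q := Q) hx a k
  have hpx : ∀ a k, MemLp (fun ω => predCoef A Q x a k ω * x a k ω) 4 μ := fun a k =>
    memLp_four_mul_of_indepFun (indepFun_past hm hind k (measurable_predCoef hx hQ a k)
      ((hx a).measurable k)) (hp4 a k) ((hx a).memLp k)
  have hk : ∀ k, ∫ ω, chaosDiff A Q x k ω ^ 4 ∂μ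
      ≤ 8 * C * ∑ a, ∫ ω, predCoef A Q x a k ω ^ 4 ∂μ := fun k => by
    have h1 : ∫ ω, chaosDiff A Q x k ω ^ 4 ∂μ
        ≤ ∫ ω, 8 * ∑ a, (predCoef A Q x a k ω * x a k ω) ^ 4 ∂μ := by
      refine integral_mono ?_ ((integrable_finsetSum _ fun a _ =>
        (hpx a k).integrable_pow_four).const_mul 8) fun ω => ?_
      · have h : MemLp (chaosDiff A Q x k) 4 μ := memLp_finsetSum _ fun a _ => hpx a k
        exact h.integrable_pow_four
      · simp only [chaosDiff, Fin.sum_univ_two]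
        generalize predCoef A Q x 0 k ω * x 0 k ω = p
        generalize predCoef A Q x 1 k ω * x 1 k ω = q
        have h2 : (p + q) ^ 2 ≤ 2 * (p ^ 2 + q ^ 2) := by nlinarith [sq_nonneg (p - q)]
        have h3 : ((p + q) ^ 2) ^ 2 ≤ (2 * (p ^ 2 + q ^ 2)) ^ 2 :=
          pow_le_pow_left₀ (sq_nonneg _) h2 2
        nlinarith [sq_nonneg (p ^ 2 - q ^ 2)]
    refine h1.trans ?_
    rw [integral_const_mul, integral_finsetSum _ fun a _ => (hpx a k).integrable_pow_four, mul_assoc,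
      Finset.mul_sum Finset.univ _ C]
    refine mul_le_mul_of_nonneg_left (Finset.sum_le_sum fun a _ => ?_) (by norm_num)
    have hi : IndepFun (fun ω => predCoef A Q x a k ω ^ 4) (fun ω => x a k ω ^ 4) μ :=
      (indepFun_past hm hind k (measurable_predCoef hx hQ a k) ((hx a).measurable k)).comp
        (φ := fun x : ℝ => x ^ 4) (ψ := fun x : ℝ => x ^ 4) (by fun_prop) (by fun_prop)
    simp_rw [mul_pow]
    rw [hi.integral_fun_mul_eq_mul_integral ((hp4 a k).1.pow 4) (((hx a).memLp k).1.pow 4), mul_comm]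
    exact mul_le_mul_of_nonneg_right ((hx a).moment k) (integral_nonneg fun ω => by positivity)
  refine (Finset.sum_le_sum fun k _ => hk k).trans ?_
  rw [← Finset.mul_sum, Finset.sum_comm]
  have h4 := Finset.sum_le_sum fun a (_ : a ∈ Finset.univ) =>
    sum_integral_predCoef_pow_four_le (A := A) hm hind hC hx hτ a
  have h5 : ∑ a, 27 * (∑ k, A a k ^ 4 + 20 * C ^ 2 * τ)
      = 27 * (∑ a, ∑ k, A a k ^ 4 + 40 * C ^ 2 * τ) := by
    simp only [Fin.sum_univ_two]; ring
  rw [h5] at h4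
  have h6 : 0 ≤ ∑ a, ∑ k, A a k ^ 4 + 40 * C ^ 2 * τ := by
    have h7 : 0 ≤ ∑ a, ∑ k, A a k ^ 4 :=
      Finset.sum_nonneg fun _ _ => Finset.sum_nonneg fun _ _ => by positivity
    have h8 : 0 ≤ τ := (gramSq_nonneg _).trans (hτ 0 0)
    positivity
  calc _ ≤ 8 * C * (27 * (∑ a, ∑ k, A a k ^ 4 + 40 * C ^ 2 * τ)) :=
        mul_le_mul_of_nonneg_left h4 (by linarith)
    _ = 216 * C * (∑ a, ∑ k, A a k ^ 4 + 40 * C ^ 2 * τ) := by ring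
    _ ≤ _ := mul_le_mul_of_nonneg_right (by nlinarith) h6

lemma sum_integral_chaosVar_sq_le (hm : ∀ i, m i ≤ mΩ) (hind : iIndep m μ) (hC : 1 ≤ C)
    (hx : ∀ a, IsNoise μ m C (x a)) (hτ : ∀ a c, gramSq (Q a c) ≤ τ) :
    ∑ k, ∫ ω, chaosVar μ A Q x k ω ^ 2 ∂μ
      ≤ 216 * C ^ 2 * (∑ a, ∑ k, A a k ^ 4 + 40 * C ^ 2 * τ) := by
  have hp4 := fun a k => memLp_predCoef (A := A) (Q := Q) hx a k
  have hk : ∀ k, ∫ ω, chaosVar μ A Q x k ω ^ 2 ∂μ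
      ≤ 8 * C ^ 2 * ∑ a, ∫ ω, predCoef A Q x a k ω ^ 4 ∂μ := fun k => by
    have h1 : ∫ ω, chaosVar μ A Q x k ω ^ 2 ∂μ
        ≤ ∫ ω, 8 * C ^ 2 * ∑ a, predCoef A Q x a k ω ^ 4 ∂μ := by
      refine integral_mono ?_ ((integrable_finsetSum _ fun a _ =>
        (hp4 a k).integrable_pow_four).const_mul _) fun ω => ?_
      · have h : MemLp (chaosVar μ A Q x k) 2 μ :=
          memLp_finsetSum _ fun a _ => memLp_finsetSum _ fun b _ =>
            (memLp_two_mul_of_memLp_four (hp4 a k) (hp4 b k)).const_mul _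
        exact h.integrable_sq
      · have hσ : ∀ a b, |∫ ω', x a k ω' * x b k ω' ∂μ| ≤ C := fun a b =>
          (hx a).abs_integral_mul_le hC (hx b) k
        have h2 : |chaosVar μ A Q x k ω|
            ≤ C * (|predCoef A Q x 0 k ω| + |predCoef A Q x 1 k ω|) ^ 2 := by
          have h3 : |chaosVar μ A Q x k ω|
              ≤ ∑ a, ∑ b, C * (|predCoef A Q x a k ω| * |predCoef A Q x b k ω|) := by
            refine (Finset.abs_sum_le_sum_abs _ _).trans (Finset.sum_le_sum fun a _ => ?_)
            refine (Finset.abs_sum_le_sum_abs _ _).trans (Finset.sum_le_sum fun b _ => ?_)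
            rw [abs_mul, abs_mul]
            exact mul_le_mul_of_nonneg_right (hσ a b) (by positivity)
          refine h3.trans (le_of_eq ?_)
          simp only [Fin.sum_univ_two]
          ring
        simp only [Fin.sum_univ_two]
        have h4 := pow_le_pow_left₀ (abs_nonneg _) h2 2
        rw [sq_abs] at h4
        refine h4.trans ?_
        have e0 : predCoef A Q x 0 k ω ^ 4 = |predCoef A Q x 0 k ω| ^ 4 :=
          (Even.pow_abs (by decide) _).symm
        have e1 : predCoef A Q x 1 k ω ^ 4 = |predCoef A Q x 1 k ω| ^ 4 :=
          (Even.pow_abs (by decide) _).symm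
        rw [e0, e1]
        generalize |predCoef A Q x 0 k ω| = p
        generalize |predCoef A Q x 1 k ω| = q
        have h5 : (p + q) ^ 2 ≤ 2 * (p ^ 2 + q ^ 2) := by nlinarith [sq_nonneg (p - q)]
        have h6 : ((p + q) ^ 2) ^ 2 ≤ (2 * (p ^ 2 + q ^ 2)) ^ 2 :=
          pow_le_pow_left₀ (sq_nonneg _) h5 2
        have h7 : ((p + q) ^ 2) ^ 2 ≤ 8 * (p ^ 4 + q ^ 4) := by
          nlinarith [sq_nonneg (p ^ 2 - q ^ 2)]
        have h8 := mul_le_mul_of_nonneg_left h7 (sq_nonneg C)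
        linarith
    refine h1.trans (le_of_eq ?_)
    rw [integral_const_mul, integral_finsetSum _ fun a _ => (hp4 a k).integrable_pow_four]
  refine (Finset.sum_le_sum fun k _ => hk k).trans ?_
  rw [← Finset.mul_sum, Finset.sum_comm]
  have h4 := Finset.sum_le_sum fun a (_ : a ∈ Finset.univ) =>
    sum_integral_predCoef_pow_four_le (A := A) hm hind hC hx hτ a
  have h5 : ∑ a, 27 * (∑ k, A a k ^ 4 + 20 * C ^ 2 * τ)
      = 27 * (∑ a, ∑ k, A a k ^ 4 + 40 * C ^ 2 * τ) := by
    simp only [Fin.sum_univ_two]; ring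
  rw [h5] at h4
  calc _ ≤ 8 * C ^ 2 * (27 * (∑ a, ∑ k, A a k ^ 4 + 40 * C ^ 2 * τ)) :=
        mul_le_mul_of_nonneg_left h4 (by positivity)
    _ = _ := by ring

lemma IsNoise.variance_weighted_linear_le (hm : ∀ i, m i ≤ mΩ) (hind : iIndep m μ) (hC : 1 ≤ C)
    {y : Fin n → Ω → ℝ} (hy : IsNoise μ m C y) {R : Matrix (Fin n) (Fin n) ℝ} (hR : gramSq R ≤ τ)
    {s a : Fin n → ℝ} (hs : ∀ k, |s k| ≤ C) {D : ℝ} (hD : ∑ k, a k ^ 2 ≤ D) :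
    Var[fun ω => ∑ k, s k * (a k * ∑ j, R k j * y j ω); μ] ≤ C ^ 4 * (√τ * D) := by
  have e1 : (fun ω => ∑ k, s k * (a k * ∑ j, R k j * y j ω))
      = fun ω => ∑ j, (∑ k, (s k * a k) * R k j) * y j ω := by
    ext ω
    simp_rw [Finset.sum_mul, Finset.mul_sum]
    rw [Finset.sum_comm]
    exact Finset.sum_congr rfl fun j _ => Finset.sum_congr rfl fun k _ => by ring
  have hD0 : 0 ≤ D := (Finset.sum_nonneg fun _ _ => sq_nonneg _).trans hD
  rw [e1]
  refine (variance_le_expectation_sq (hy.memLp_linear _).1).trans ?_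
  refine (hy.integral_sq_linear_le hm hind hC Finset.univ _).trans ?_
  have h1 := sum_sq_weighted_col_le R (fun k => s k * a k)
  have h2 : ∑ k, (s k * a k) ^ 2 ≤ C ^ 2 * D := by
    refine le_trans ?_ (mul_le_mul_of_nonneg_left hD (sq_nonneg C))
    rw [Finset.mul_sum]
    refine Finset.sum_le_sum fun k _ => ?_
    rw [mul_pow]
    refine mul_le_mul_of_nonneg_right ?_ (sq_nonneg _)
    rw [← sq_abs]
    exact pow_le_pow_left₀ (abs_nonneg _) (hs k) 2
  have h3 : √(gramSq R) ≤ √τ := Real.sqrt_le_sqrt hR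
  calc _ ≤ C * (√τ * (C ^ 2 * D)) := mul_le_mul_of_nonneg_left
          (h1.trans (mul_le_mul h3 h2 (Finset.sum_nonneg fun _ _ => sq_nonneg _)
            (Real.sqrt_nonneg _))) (by linarith)
    _ = C ^ 3 * (√τ * D) := by ring
    _ ≤ C ^ 4 * (√τ * D) := mul_le_mul_of_nonneg_right (pow_le_pow_right₀ hC (by norm_num))
        (by positivity)

/-- The accumulated conditional variance is a polynomial of degree two in the noise; its linear and
its quadratic terms are both controlled by the Gram matrices of the quadratic coefficients. -/
lemma variance_sum_chaosVar_le (hm : ∀ i, m i ≤ mΩ) (hind : iIndep m μ) (hC : 1 ≤ C)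
    (hx : ∀ a, IsNoise μ m C (x a)) (hτ : ∀ a c, gramSq (Q a c) ≤ τ) {D : ℝ}
    (hD : ∀ a, ∑ k, A a k ^ 2 ≤ D) :
    Var[fun ω => ∑ k, chaosVar μ A Q x k ω; μ] ≤ 11664 * C ^ 4 * (τ + √τ * D) := by
  set z : Fin 2 → Option (Fin 2) → Fin n → Ω → ℝ := fun a o k ω =>
    o.elim (A a k) (fun c => ∑ j, Q a c k j * x c j ω) with hz
  set σ : Fin 2 → Fin 2 → Fin n → ℝ := fun a b k => ∫ ω', x a k ω' * x b k ω' ∂μ with hσdef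
  have hσ : ∀ a b k, |σ a b k| ≤ C := fun a b k => (hx a).abs_integral_mul_le hC (hx b) k
  have hz4 : ∀ a o k, MemLp (z a o k) 4 μ := fun a o k => by
    cases o with
    | none => exact memLp_const _
    | some c => exact (hx c).memLp_linear _
  set Z : Fin 2 × Fin 2 × Option (Fin 2) × Option (Fin 2) → Ω → ℝ := fun p ω =>
    ∑ k, σ p.1 p.2.1 k * (z p.1 p.2.2.1 k ω * z p.2.1 p.2.2.2 k ω) with hZ
  have hZ2 : ∀ p ∈ Finset.univ, MemLp (Z p) 2 μ := fun p _ =>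
    memLp_finsetSum _ fun k _ => (memLp_two_mul_of_memLp_four (hz4 _ _ _) (hz4 _ _ _)).const_mul _
  have hpred : ∀ a k ω, predCoef A Q x a k ω = ∑ o, z a o k ω := fun a k ω => by
    rw [Fintype.sum_option]; rfl
  have e : (fun ω => ∑ k, chaosVar μ A Q x k ω) = fun ω => ∑ p, Z p ω := by
    ext ω
    simp only [hZ, chaosVar, hpred]
    simp_rw [Fintype.sum_prod_type]
    rw [Finset.sum_comm]
    refine Finset.sum_congr rfl fun a _ => ?_
    rw [Finset.sum_comm]
    refine Finset.sum_congr rfl fun b _ => ?_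
    simp_rw [Finset.sum_mul_sum, Finset.mul_sum]
    rw [Finset.sum_comm]
    refine Finset.sum_congr rfl fun o _ => ?_
    rw [Finset.sum_comm]
  have hτ0 : 0 ≤ τ := (gramSq_nonneg _).trans (hτ 0 0)
  have hD0 : 0 ≤ D := (Finset.sum_nonneg fun _ _ => sq_nonneg _).trans (hD 0)
  have hC4 : 0 ≤ C ^ 4 := by positivity
  have hvar : ∀ p, Var[Z p; μ] ≤ 9 * C ^ 4 * (τ + √τ * D) := fun p => by
    obtain ⟨a, b, o, o'⟩ := p
    have hT : 0 ≤ C ^ 4 * τ := by positivity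
    have hS : 0 ≤ C ^ 4 * (√τ * D) := by positivity
    match o, o' with
    | none, none =>
      have : Z (a, b, none, none) = fun _ => ∑ k, σ a b k * (A a k * A b k) := rfl
      rw [this, variance_eq_integral aemeasurable_const]
      simp only [integral_const, probReal_univ, one_smul, sub_self]
      nlinarith
    | none, some d =>
      have h := (hx d).variance_weighted_linear_le hm hind hC (hτ b d) (hσ a b) (hD a)
      have : Z (a, b, none, some d)
        = fun ω => ∑ k, σ a b k * (A a k * ∑ j, Q b d k j * x d j ω) := rfl
      rw [this]
      linarith
    | some c, none =>
      have h := (hx c).variance_weighted_linear_le hm hind hC (hτ a c) (hσ a b) (hD b)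
      have : Z (a, b, some c, none)
          = fun ω => ∑ k, σ a b k * (A b k * ∑ j, Q a c k j * x c j ω) := by
        ext ω
        exact Finset.sum_congr rfl fun k _ => by
          rw [mul_comm (A b k)]; rfl
      rw [this]
      linarith
    | some c, some d =>
      have e2 : Z (a, b, some c, some d)
          = fun ω => ∑ j, ∑ l, (∑ k, σ a b k * Q a c k j * Q b d k l) * x c j ω * x d l ω := by
        ext ω
        simp only [hZ, hz, Option.elim]
        simp_rw [Finset.sum_mul_sum, Finset.mul_sum, Finset.sum_mul]
        rw [Finset.sum_comm]
        refine Finset.sum_congr rfl fun j _ => ?_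
        rw [Finset.sum_comm]
        exact Finset.sum_congr rfl fun l _ => Finset.sum_congr rfl fun k _ => by ring
      have h1 := (hx c).variance_bilinear_le hm hind hC (hx d)
        (fun j l => ∑ k, σ a b k * Q a c k j * Q b d k l)
      have h2 := sum_sq_sandwich_le (Q a c) (Q b d) (hσ a b) (hτ a c) (hτ b d)
      rw [e2]
      refine h1.trans ?_
      have h3 := mul_le_mul_of_nonneg_left h2 (show 0 ≤ 9 * C ^ 2 by positivity)
      nlinarith
  rw [e]
  refine (variance_sum_le_card_mul _ hZ2).trans ?_
  refine (mul_le_mul_of_nonneg_left (Finset.sum_le_sum fun p _ => hvar p)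
    (Nat.cast_nonneg _)).trans (le_of_eq ?_)
  simp only [Finset.sum_const, Finset.card_univ, Fintype.card_prod, Fintype.card_option,
    Fintype.card_fin, nsmul_eq_mul]
  push_cast
  ring

/-- The differences of the chaos are uncorrelated, so that the variances add up. -/
lemma integral_sq_sum_chaosDiff (hm : ∀ i, m i ≤ mΩ) (hind : iIndep m μ)
    (hx : ∀ a, IsNoise μ m C (x a)) (hQ : ∀ a c k j, ¬ j < k → Q a c k j = 0) :
    ∫ ω, (∑ k, chaosDiff A Q x k ω) ^ 2 ∂μ = ∑ k, ∫ ω, chaosDiff A Q x k ω ^ 2 ∂μ := by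
  have hM := isMartingaleDiff_chaos (A := A) hm hind hx hQ
  have hp4 := fun a k => memLp_predCoef (A := A) (Q := Q) hx a k
  have hD2 : ∀ k, MemLp (chaosDiff A Q x k) 2 μ := fun k =>
    (hM.memLp_diff k).mono_exponent (by norm_num)
  refine integral_sq_sum_of_orthogonal _ (fun k _ => hD2 k) ?_
  have key : ∀ i j : Fin n, i < j →
      ∫ ω, chaosDiff A Q x i ω * chaosDiff A Q x j ω ∂μ = 0 := fun i j hij => by
    have hi : Measurable[past m j] (chaosDiff A Q x i) :=
      (hM.measurable_diff i).mono (past_mono (Nat.succ_le_of_lt (Fin.lt_def.1 hij))) le_rfl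
    have hint : ∀ a, Integrable
        (fun ω => chaosDiff A Q x i ω * (predCoef A Q x a j ω * x a j ω)) μ := fun a =>
      (hD2 i).integrable_mul (memLp_two_mul_of_memLp_four (hp4 a j) ((hx a).memLp j))
    have e : ∀ ω, chaosDiff A Q x i ω * chaosDiff A Q x j ω
        = ∑ a, chaosDiff A Q x i ω * (predCoef A Q x a j ω * x a j ω) := fun ω => by
      rw [← Finset.mul_sum]; rfl
    simp_rw [e]
    rw [integral_finsetSum _ fun a _ => hint a]
    refine Finset.sum_eq_zero fun a _ => ?_
    rw [← (hx a).integral_mul_past hm hind (hi.mul (measurable_predCoef (A := A) hx hQ a j))]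
    refine integral_congr_ae (ae_of_all _ fun ω => ?_)
    simp only [Pi.mul_apply]
    ring
  intro i _ j _ hij
  rcases lt_or_gt_of_ne hij with h | h
  · exact key i j h
  · rw [← key j i h]
    refine integral_congr_ae (ae_of_all _ fun ω => ?_)
    ring

lemma IsMartingaleDiff.integral_sq_eq {ℱ : ℕ → MeasurableSpace Ω} {M s : Fin n → Ω → ℝ}
    (h : IsMartingaleDiff μ ℱ M s) (k : Fin n) : ∫ ω, M k ω ^ 2 ∂μ = ∫ ω, s k ω ∂μ := by
  have h2 : Integrable (fun ω => M k ω ^ 2) μ :=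
    ((h.memLp_diff k).mono_exponent (by norm_num)).integrable_sq
  have := h.integral_sq k (fun _ => 1) 1 (@measurable_const _ _ _ (ℱ k) _) (by simp)
  have e : ∀ ω, (1 : ℂ) * ((M k ω : ℂ) ^ 2 - s k ω) = ((M k ω ^ 2 - s k ω : ℝ) : ℂ) := fun ω => by
    push_cast; ring
  simp_rw [e] at this
  rw [integral_complex_ofReal, Complex.ofReal_eq_zero,
    integral_sub h2 ((h.memLp_var k).integrable (by norm_num))] at this
  linarith

/-- A quantitative central limit theorem for a second-order chaos of variance `v`. The third moments
of the differences are split between second and fourth moments by means of `ε`. -/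
theorem norm_charFun_chaos_sub_le (hm : ∀ i, m i ≤ mΩ) (hind : iIndep m μ) (hC : 1 ≤ C)
    (hx : ∀ a, IsNoise μ m C (x a)) (hQ : ∀ a c k j, ¬ j < k → Q a c k j = 0)
    (hτ : ∀ a c, gramSq (Q a c) ≤ τ) {D v α ε : ℝ} (hD : ∀ a, ∑ k, A a k ^ 2 ≤ D)
    (hα : ∑ a, ∑ k, A a k ^ 4 ≤ α) (hε : 0 < ε)
    (hv : ∫ ω, (∑ k, chaosDiff A Q x k ω) ^ 2 ∂μ = v) :
    ‖∫ ω, Complex.exp ((∑ k, chaosDiff A Q x k ω : ℝ) * Complex.I) ∂μ - (Real.exp (-v / 2) : ℝ)‖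
      ≤ 2 * (4 * (ε * v + ε⁻¹ * (216 * C ^ 2 * (α + 40 * C ^ 2 * τ)))
        + 216 * C ^ 2 * (α + 40 * C ^ 2 * τ) + 2 * √(11664 * C ^ 4 * (τ + √τ * D))) := by
  have hM := isMartingaleDiff_chaos (A := A) hm hind hx hQ
  have hv0 : 0 ≤ v := by rw [← hv]; exact integral_nonneg fun _ => sq_nonneg _
  have h := hM.norm_charFun_sub_le past_mono (past_le hm) hv0
  rw [integral_sq_sum_chaosDiff hm hind hx hQ] at hv
  have hi2 : ∀ k, Integrable (fun ω => chaosDiff A Q x k ω ^ 2) μ := fun k =>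
    ((hM.memLp_diff k).mono_exponent (by norm_num)).integrable_sq
  have hi4 := fun k => (hM.memLp_diff k).integrable_pow_four
  have b4 : ∑ k, ∫ ω, chaosDiff A Q x k ω ^ 4 ∂μ ≤ 216 * C ^ 2 * (α + 40 * C ^ 2 * τ) :=
    (sum_integral_chaosDiff_pow_four_le hm hind hC hx hQ hτ).trans
      (mul_le_mul_of_nonneg_left (by linarith) (by positivity))
  have bs : ∑ k, ∫ ω, chaosVar μ A Q x k ω ^ 2 ∂μ ≤ 216 * C ^ 2 * (α + 40 * C ^ 2 * τ) :=
    (sum_integral_chaosVar_sq_le hm hind hC hx hτ).trans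
      (mul_le_mul_of_nonneg_left (by linarith) (by positivity))
  have b3 : ∑ k, ∫ ω, (4 * |chaosDiff A Q x k ω| ^ 3 + chaosVar μ A Q x k ω ^ 2) ∂μ
      ≤ 4 * (ε * v + ε⁻¹ * (216 * C ^ 2 * (α + 40 * C ^ 2 * τ)))
        + 216 * C ^ 2 * (α + 40 * C ^ 2 * τ) := by
    have hk : ∀ k, ∫ ω, (4 * |chaosDiff A Q x k ω| ^ 3 + chaosVar μ A Q x k ω ^ 2) ∂μ
        ≤ 4 * (ε * ∫ ω, chaosDiff A Q x k ω ^ 2 ∂μ + ε⁻¹ * ∫ ω, chaosDiff A Q x k ω ^ 4 ∂μ)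
          + ∫ ω, chaosVar μ A Q x k ω ^ 2 ∂μ := fun k => by
      rw [integral_add ((hM.memLp_diff k).integrable_abs_pow_three.const_mul 4)
        (hM.memLp_var k).integrable_sq, integral_const_mul]
      refine add_le_add_left (mul_le_mul_of_nonneg_left ?_ (by norm_num)) _
      rw [← integral_const_mul, ← integral_const_mul, ← integral_add ((hi2 k).const_mul _)
        ((hi4 k).const_mul _)]
      refine integral_mono (hM.memLp_diff k).integrable_abs_pow_three
        (((hi2 k).const_mul _).add ((hi4 k).const_mul _)) fun ω => ?_
      have e4 : chaosDiff A Q x k ω ^ 4 = |chaosDiff A Q x k ω| ^ 4 :=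
        (Even.pow_abs (by decide) _).symm
      have e2 := sq_abs (chaosDiff A Q x k ω)
      simp only [e4, ← e2]
      generalize |chaosDiff A Q x k ω| = u
      have : ε * u ^ 2 + ε⁻¹ * u ^ 4 - u ^ 3
          = ε⁻¹ * u ^ 2 * ((u - ε / 2) ^ 2 + 3 / 4 * ε ^ 2) := by
        field_simp
        ring
      have h0 : 0 ≤ ε⁻¹ * u ^ 2 * ((u - ε / 2) ^ 2 + 3 / 4 * ε ^ 2) := by positivity
      linarith
    refine (Finset.sum_le_sum fun k _ => hk k).trans ?_
    rw [Finset.sum_add_distrib, ← Finset.mul_sum, Finset.sum_add_distrib, ← Finset.mul_sum,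
      ← Finset.mul_sum, hv]
    have := mul_le_mul_of_nonneg_left b4 (inv_pos.2 hε).le
    linarith
  have hV2 : MemLp (fun ω => ∑ k, chaosVar μ A Q x k ω) 2 μ :=
    memLp_finsetSum _ fun k _ => hM.memLp_var k
  have hEV : ∫ ω, ∑ k, chaosVar μ A Q x k ω ∂μ = v := by
    rw [integral_finsetSum _ fun k _ => (hM.memLp_var k).integrable (by norm_num), ← hv]
    exact Finset.sum_congr rfl fun k _ => (hM.integral_sq_eq k).symm
  have hV := integral_abs_sub_integral_le hV2
  rw [hEV] at hV
  have hV' := hV.trans (Real.sqrt_le_sqrt (variance_sum_chaosVar_le hm hind hC hx hτ hD))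
  linarith

end

/-! ### Leave-one-out sums and triangular parts -/

section

variable {n : ℕ} (G : Matrix (Fin n) (Fin n) ℝ)

lemma sum_erase_mul_eq (f : Fin n → ℝ) (i : Fin n) :
    ∑ j ∈ Finset.univ.erase i, G i j * f j
      = ∑ j, lowerPart G i j * f j + ∑ j, upperPart G i j * f j := by
  rw [← Finset.sum_add_distrib, Finset.sum_erase_eq_sub (Finset.mem_univ i)]
  rw [eq_comm, eq_sub_iff_add_eq]
  have : G i i * f i = ∑ j, if j = i then G i j * f j else 0 := by simp
  rw [this, ← Finset.sum_add_distrib]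
  refine Finset.sum_congr rfl fun j _ => ?_
  simp only [lowerPart, upperPart, Matrix.of_apply]
  rcases lt_trichotomy j i with h | h | h
  · simp [h, h.not_gt, h.ne]
  · simp [h]
  · simp [h, h.not_gt, h.ne']

lemma offSum_eq_sum_mul_looSum (a b : Fin n → ℝ) : offSum G a b = ∑ i, a i * looSum G b i := by
  simp only [offSum, looSum, Finset.mul_sum]
  exact Finset.sum_congr rfl fun i _ => Finset.sum_congr rfl fun j _ => by ring

/-- An off-diagonal bilinear form, ordered so that the larger index comes last. -/
lemma offSum_eq_sum_lower_add_sum_upper (a b : Fin n → ℝ) :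
    offSum G a b = ∑ k, ∑ j, lowerPart G k j * b j * a k
      + ∑ k, ∑ j, (upperPart G)ᵀ k j * a j * b k := by
  have h1 : ∑ k, ∑ j, (upperPart G)ᵀ k j * a j * b k = ∑ i, ∑ j, upperPart G i j * b j * a i := by
    rw [Finset.sum_comm]
    refine Finset.sum_congr rfl fun i _ => Finset.sum_congr rfl fun j _ => ?_
    rw [Matrix.transpose_apply]; ring
  rw [h1, offSum_eq_sum_mul_looSum, ← Finset.sum_add_distrib]
  refine Finset.sum_congr rfl fun i _ => ?_
  rw [looSum, sum_erase_mul_eq, mul_add, Finset.mul_sum, Finset.mul_sum]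
  congr 1 <;> exact Finset.sum_congr rfl fun j _ => by ring

lemma offSum_comm (a b : Fin n → ℝ) : offSum G a b = offSum Gᵀ b a := by
  simp only [offSum]
  rw [Finset.sum_comm' (t' := Finset.univ) (s' := fun j => Finset.univ.erase j)]
  · exact Finset.sum_congr rfl fun i _ => Finset.sum_congr rfl fun j _ => by
      rw [Matrix.transpose_apply]; ring
  · intro x y
    simp [eq_comm]

lemma offSum_add_left (a a' b : Fin n → ℝ) :
    offSum G (fun i => a i + a' i) b = offSum G a b + offSum G a' b := by
  simp only [offSum_eq_sum_mul_looSum, add_mul, Finset.sum_add_distrib]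

lemma offSum_add_right (a b b' : Fin n → ℝ) :
    offSum G a (fun i => b i + b' i) = offSum G a b + offSum G a b' := by
  rw [offSum_comm, offSum_add_left, ← offSum_comm, ← offSum_comm]

lemma offSum_sub_mul_left (a a' b : Fin n → ℝ) (s : ℝ) :
    offSum G (fun i => a i - a' i * s) b = offSum G a b - s * offSum G a' b := by
  simp only [offSum_eq_sum_mul_looSum, Finset.mul_sum, ← Finset.sum_sub_distrib]
  exact Finset.sum_congr rfl fun i _ => by ring

lemma sum_erase_add_transpose_mul (f : Fin n → ℝ) (i : Fin n) :
    ∑ j ∈ Finset.univ.erase i, (G i j + G j i) * f j = looSum G f i + looSum Gᵀ f i := by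
  simp only [looSum, Matrix.transpose_apply, add_mul, Finset.sum_add_distrib]

lemma gramSq_transpose_le (Q : Matrix (Fin n) (Fin n) ℝ) : gramSq Qᵀ ≤ gramSq Q := by
  have h := sum_sq_sandwich_le (d := fun _ => 1) (C := 1) Q Q (by simp) le_rfl le_rfl
  simp only [one_mul, one_pow] at h
  refine le_trans (le_of_eq ?_) h
  simp [gramSq, Matrix.mul_apply]

lemma gramSq_smul (s : ℝ) (Q : Matrix (Fin n) (Fin n) ℝ) : gramSq (s • Q) = s ^ 4 * gramSq Q := by
  simp only [gramSq, Finset.mul_sum]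
  refine Finset.sum_congr rfl fun k _ => Finset.sum_congr rfl fun l _ => ?_
  simp only [Matrix.transpose_smul, Matrix.smul_mul, Matrix.mul_smul, Matrix.smul_apply, smul_eq_mul]
  ring

lemma gramSq_add_le {P N : Matrix (Fin n) (Fin n) ℝ} {τ : ℝ} (hP : gramSq P ≤ τ)
    (hN : gramSq N ≤ τ) : gramSq (P + N) ≤ 16 * τ := by
  have cross : ∀ {P N : Matrix (Fin n) (Fin n) ℝ}, gramSq P ≤ τ → gramSq N ≤ τ →
      ∑ k, ∑ l, (P * Nᵀ) k l ^ 2 ≤ τ := fun {P N} hP hN => by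
    have h := sum_sq_sandwich_le (d := fun _ => 1) (C := 1) Pᵀ Nᵀ (by simp)
      ((gramSq_transpose_le P).trans hP) ((gramSq_transpose_le N).trans hN)
    simpa [Matrix.mul_apply] using h
  have h1 := cross hP hP
  have h2 := cross hN hN
  have h3 := cross hP hN
  have h4 := cross hN hP
  have : gramSq (P + N) ≤ ∑ k, ∑ l, 4 * ((P * Pᵀ) k l ^ 2 + (N * Nᵀ) k l ^ 2
      + (P * Nᵀ) k l ^ 2 + (N * Pᵀ) k l ^ 2) := by
    refine Finset.sum_le_sum fun k _ => Finset.sum_le_sum fun l _ => ?_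
    have e : ((P + N) * (P + N)ᵀ) k l
        = (P * Pᵀ) k l + (N * Nᵀ) k l + (P * Nᵀ) k l + (N * Pᵀ) k l := by
      rw [Matrix.transpose_add, Matrix.add_mul, Matrix.mul_add, Matrix.mul_add]
      simp only [Matrix.add_apply]
      ring
    rw [e]
    generalize (P * Pᵀ) k l = p
    generalize (N * Nᵀ) k l = q
    generalize (P * Nᵀ) k l = r
    generalize (N * Pᵀ) k l = s
    nlinarith [sq_nonneg (p - q), sq_nonneg (p - r), sq_nonneg (p - s), sq_nonneg (q - r),
      sq_nonneg (q - s), sq_nonneg (r - s)]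
  refine this.trans ?_
  simp only [← Finset.mul_sum, Finset.sum_add_distrib]
  linarith

open scoped Matrix.Norms.Frobenius in
lemma frobNorm_nonneg (A : Matrix (Fin n) (Fin n) ℝ) : 0 ≤ frobNorm A := norm_nonneg A

lemma frobNorm_smul_mul_transpose (s : ℝ) (Q : Matrix (Fin n) (Fin n) ℝ) :
    frobNorm (s • (Q * Qᵀ)) ^ 2 = s ^ 2 * gramSq Q := by
  rw [frobNorm, Matrix.frobenius_norm_def, ← Real.sqrt_eq_rpow, Real.sq_sqrt (by positivity)]
  simp only [gramSq, Finset.mul_sum]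
  exact Finset.sum_congr rfl fun k _ => Finset.sum_congr rfl fun l _ => by
    simp [mul_pow]

/-- The coefficients of `c 0 ∑∑ Gᵢⱼ νᵢ νⱼ + c 1 ∑∑ Gᵢⱼ νᵢ ηⱼ + c 2 ∑∑ Gᵢⱼ ηᵢ ηⱼ`, ordered by the larger
index; noise `0` is `ν` and noise `1` is `η`. -/
def quadCoef (c : Fin 3 → ℝ) : Fin 2 → Fin 2 → Matrix (Fin n) (Fin n) ℝ :=
  ![![c 0 • (lowerPart G + (upperPart G)ᵀ), c 1 • lowerPart G],
    ![c 1 • (upperPart G)ᵀ, c 2 • (lowerPart G + (upperPart G)ᵀ)]]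

lemma quadCoef_eq_zero (c : Fin 3 → ℝ) (a b : Fin 2) (k j : Fin n) (h : ¬ j < k) :
    quadCoef G c a b k j = 0 := by
  fin_cases a <;> fin_cases b <;> simp [quadCoef, lowerPart, upperPart, h]

lemma gramSq_quadCoef_le {c : Fin 3 → ℝ} {s : ℝ} (hc : ∀ i, c i ^ 2 ≤ s) (a b : Fin 2) :
    gramSq (quadCoef G c a b)
      ≤ 16 * s ^ 2 * (gramSq (lowerPart G) + gramSq (upperPart G)) := by
  set τ := gramSq (lowerPart G) + gramSq (upperPart G) with hτ
  have hL := gramSq_nonneg (lowerPart G)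
  have hU := gramSq_nonneg (upperPart G)
  have h1 : gramSq (lowerPart G) ≤ τ := by linarith
  have h2 : gramSq (upperPart G)ᵀ ≤ τ := (gramSq_transpose_le _).trans (by linarith)
  have h3 := gramSq_add_le h1 h2
  have hτ0 : 0 ≤ τ := by linarith
  have hc4 : ∀ i, c i ^ 4 ≤ s ^ 2 := fun i => by
    have := pow_le_pow_left₀ (sq_nonneg _) (hc i) 2
    calc c i ^ 4 = (c i ^ 2) ^ 2 := by ring
      _ ≤ _ := this
  have key : ∀ (i : Fin 3) {P : Matrix (Fin n) (Fin n) ℝ}, gramSq P ≤ 16 * τ →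
      gramSq (c i • P) ≤ 16 * s ^ 2 * τ := fun i P hP => by
    rw [gramSq_smul]
    calc c i ^ 4 * gramSq P ≤ s ^ 2 * (16 * τ) :=
          mul_le_mul (hc4 i) hP (gramSq_nonneg _) (sq_nonneg _)
      _ = _ := by ring
  fin_cases a <;> fin_cases b
  · exact key 0 h3
  · exact key 1 (by linarith)
  · exact key 1 (by linarith)
  · exact key 2 h3

end

/-! ### The statistics as a second-order chaos -/

namespace IVModel

section

variable {n K L : ℕ} {Ω : Type*} [mΩ : MeasurableSpace Ω] {P : Measure Ω}
  (M : IVModel n K L P) (G : Matrix (Fin n) (Fin n) ℝ) (β : ℝ)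

/-- The two errors `ν` and `η`. -/
def noise : Fin 2 → Fin n → Ω → ℝ := ![M.ν β, M.η]

/-- The coefficients of the errors in the linear part of the combination of the centered statistics
with weights `c`. -/
def linCoef (c : Fin 3 → ℝ) : Fin 2 → Fin n → ℝ :=
  ![fun i => c 0 * ∑ j ∈ Finset.univ.erase i, (G i j + G j i) * M.RΔ β j + c 1 * looSum G M.R i,
    fun i => c 2 * ∑ j ∈ Finset.univ.erase i, (G i j + G j i) * M.R j
      + c 1 * looSum Gᵀ (M.RΔ β) i]

/-- The quadratic part of the combination of the centered statistics with weights `c`. -/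
def quadPart (c : Fin 3 → ℝ) (ω : Ω) : ℝ :=
  ∑ i, ∑ j ∈ Finset.univ.erase i, G i j *
    (c 0 * M.ν β i ω * M.ν β j ω + c 1 * M.ν β i ω * M.η j ω + c 2 * M.η i ω * M.η j ω)

/-- The combination of the centered statistics with weights `√K c`, as a sum of martingale
differences. -/
def chaos (c : Fin 3 → ℝ) (ω : Ω) : ℝ :=
  ∑ k, chaosDiff (M.linCoef G β c) (quadCoef G c) (M.noise β) k ω

lemma quadPart_eq_offSum (c : Fin 3 → ℝ) (ω : Ω) :
    M.quadPart G β c ω = c 0 * offSum G (fun i => M.ν β i ω) (fun i => M.ν β i ω)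
      + c 1 * offSum G (fun i => M.ν β i ω) (fun i => M.η i ω)
      + c 2 * offSum G (fun i => M.η i ω) (fun i => M.η i ω) := by
  simp only [quadPart, offSum, Finset.mul_sum, ← Finset.sum_add_distrib]
  exact Finset.sum_congr rfl fun i _ => Finset.sum_congr rfl fun j _ => by ring

lemma sum_chaosDiff_quadCoef (A : Fin 2 → Fin n → ℝ) (c : Fin 3 → ℝ) (ω : Ω) :
    ∑ k, chaosDiff A (quadCoef G c) (M.noise β) k ω
      = ∑ k, (A 0 k * M.ν β k ω + A 1 k * M.η k ω) + M.quadPart G β c ω := by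
  rw [quadPart_eq_offSum]
  simp only [offSum_eq_sum_lower_add_sum_upper, mul_add, Finset.mul_sum]
  simp only [← Finset.sum_add_distrib]
  refine Finset.sum_congr rfl fun k _ => ?_
  simp only [chaosDiff, predCoef, Fin.sum_univ_two, noise, quadCoef, Matrix.cons_val_zero,
    Matrix.cons_val_one, Matrix.smul_apply, Matrix.add_apply, smul_eq_mul, add_mul, mul_add,
    Finset.sum_mul, Finset.sum_add_distrib]
  have hc : ∀ f g : Fin n → ℝ, (∀ j, f j = g j) → ∑ j, f j = ∑ j, g j := fun f g h =>
    Finset.sum_congr rfl fun j _ => h j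
  rw [hc (fun j => c 0 * (lowerPart G k j * M.ν β j ω * M.ν β k ω))
      (fun j => c 0 * lowerPart G k j * M.ν β j ω * M.ν β k ω) (fun j => by ring),
    hc (fun j => c 0 * ((upperPart G)ᵀ k j * M.ν β j ω * M.ν β k ω))
      (fun j => c 0 * (upperPart G)ᵀ k j * M.ν β j ω * M.ν β k ω) (fun j => by ring),
    hc (fun j => c 1 * (lowerPart G k j * M.η j ω * M.ν β k ω))
      (fun j => c 1 * lowerPart G k j * M.η j ω * M.ν β k ω) (fun j => by ring),
    hc (fun j => c 1 * ((upperPart G)ᵀ k j * M.ν β j ω * M.η k ω))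
      (fun j => c 1 * (upperPart G)ᵀ k j * M.ν β j ω * M.η k ω) (fun j => by ring),
    hc (fun j => c 2 * (lowerPart G k j * M.η j ω * M.η k ω))
      (fun j => c 2 * lowerPart G k j * M.η j ω * M.η k ω) (fun j => by ring),
    hc (fun j => c 2 * ((upperPart G)ᵀ k j * M.η j ω * M.η k ω))
      (fun j => c 2 * (upperPart G)ᵀ k j * M.η j ω * M.η k ω) (fun j => by ring)]
  ring

lemma offSum_RΔ_R (hG : offSum G M.R M.R ≠ 0) (hβ : β = M.betaJIVE G) :
    offSum G (M.RΔ β) M.R = 0 := by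
  have : M.RΔ β = fun i => M.RY i - M.R i * β := rfl
  rw [this, offSum_sub_mul_left, hβ, betaJIVE, div_mul_cancel₀ _ hG, sub_self]

/-- Combinations of the centered statistics are, up to scale, second-order chaoses. The means of the
score `T_LM` cancel by definition of the estimand. -/
lemma sum_mul_T_sub_center (hG : offSum G M.R M.R ≠ 0) (hβ : β = M.betaJIVE G) (c : Fin 3 → ℝ)
    (ω : Ω) : ∑ a, c a * (M.T G β ω - M.center G β) a = 1 / √(K : ℝ) * M.chaos G β c ω := by
  have he : (fun i => M.e β i ω) = fun i => M.RΔ β i + M.ν β i ω := by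
    ext i; simp only [e, RΔ, ν, ζ, η]; ring
  have hX : (fun i => M.X i ω) = fun i => M.R i + M.η i ω := by
    ext i; simp only [η]; ring
  have h0 := M.offSum_RΔ_R G β hG hβ
  have hlin : ∀ a b : Fin n → ℝ, offSum G a b = ∑ i, looSum G b i * a i := fun a b => by
    rw [offSum_eq_sum_mul_looSum]
    exact Finset.sum_congr rfl fun i _ => mul_comm _ _
  have hlin' : ∀ a b : Fin n → ℝ, offSum G a b = ∑ i, looSum Gᵀ a i * b i := fun a b => by
    rw [offSum_comm, offSum_eq_sum_mul_looSum]
    exact Finset.sum_congr rfl fun i _ => mul_comm _ _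
  have hA : ∑ k, (M.linCoef G β c 0 k * M.ν β k ω + M.linCoef G β c 1 k * M.η k ω)
      = c 0 * (offSum G (fun i => M.ν β i ω) (M.RΔ β) + offSum G (M.RΔ β) (fun i => M.ν β i ω))
        + c 1 * (offSum G (fun i => M.ν β i ω) M.R + offSum G (M.RΔ β) (fun i => M.η i ω))
        + c 2 * (offSum G (fun i => M.η i ω) M.R + offSum G M.R (fun i => M.η i ω)) := by
    rw [hlin (fun i => M.ν β i ω) (M.RΔ β), hlin' (M.RΔ β) (fun i => M.ν β i ω),
      hlin (fun i => M.ν β i ω) M.R, hlin' (M.RΔ β) (fun i => M.η i ω),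
      hlin (fun i => M.η i ω) M.R, hlin' M.R (fun i => M.η i ω)]
    simp only [← Finset.sum_add_distrib, Finset.mul_sum]
    refine Finset.sum_congr rfl fun i _ => ?_
    simp only [linCoef, sum_erase_add_transpose_mul, Matrix.cons_val_zero, Matrix.cons_val_one]
    ring
  rw [chaos, sum_chaosDiff_quadCoef, hA, quadPart_eq_offSum]
  simp only [Fin.sum_univ_three, T, center, TAR, TLM, TFS, Pi.sub_apply, Matrix.cons_val_zero,
    Matrix.cons_val_one, Matrix.cons_val, he, hX]
  simp only [offSum_add_left, offSum_add_right]
  rw [h0]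
  ring

end

end IVModel

/-! ### Variance of the chaos -/

section

variable {Ω : Type*} [mΩ : MeasurableSpace Ω] {μ : Measure Ω} [IsProbabilityMeasure μ] {n : ℕ}
  {m : Fin n → MeasurableSpace Ω} {C : ℝ} {A : Fin 2 → Fin n → ℝ}
  {Q : Fin 2 → Fin 2 → Matrix (Fin n) (Fin n) ℝ} {x : Fin 2 → Fin n → Ω → ℝ}

lemma integral_chaosVar (hx : ∀ a, IsNoise μ m C (x a)) (k : Fin n) :
    ∫ ω, chaosVar μ A Q x k ω ∂μ
      = ∑ a, ∑ b, (∫ ω, x a k ω * x b k ω ∂μ) * (A a k * A b k)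
        + ∫ ω, chaosVar μ (fun _ _ => 0) Q x k ω ∂μ := by
  have hp4 : ∀ a, MemLp (predCoef (fun _ _ => 0) Q x a k) 4 μ := fun a => memLp_predCoef hx a k
  have hp1 : ∀ a, Integrable (predCoef (fun _ _ => 0) Q x a k) μ := fun a =>
    (hp4 a).integrable (by norm_num)
  have hpp : ∀ a b, Integrable (fun ω => predCoef (fun _ _ => 0) Q x a k ω
      * predCoef (fun _ _ => 0) Q x b k ω) μ := fun a b =>
    (memLp_two_mul_of_memLp_four (hp4 a) (hp4 b)).integrable (by norm_num)
  have hmean : ∀ a, ∫ ω, predCoef (fun _ _ => 0) Q x a k ω ∂μ = 0 := fun a => by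
    simp only [predCoef, zero_add]
    have hi : ∀ c j, Integrable (fun ω => Q a c k j * x c j ω) μ := fun c j =>
      (((hx c).memLp j).integrable (by norm_num)).const_mul _
    rw [integral_finsetSum _ fun c _ => integrable_finsetSum _ fun j _ => hi c j]
    refine Finset.sum_eq_zero fun c _ => ?_
    rw [integral_finsetSum _ fun j _ => hi c j]
    refine Finset.sum_eq_zero fun j _ => ?_
    rw [integral_const_mul, (hx c).mean, mul_zero]
  have hpred : ∀ a ω, predCoef A Q x a k ω = A a k + predCoef (fun _ _ => 0) Q x a k ω :=
    fun a ω => by simp only [predCoef, zero_add]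
  have hi0 : ∀ a b, Integrable (fun ω => (∫ ω', x a k ω' * x b k ω' ∂μ) *
      (predCoef (fun _ _ => 0) Q x a k ω * predCoef (fun _ _ => 0) Q x b k ω)) μ := fun a b =>
    (hpp a b).const_mul _
  have hi1 : ∀ a b, Integrable (fun ω => (∫ ω', x a k ω' * x b k ω' ∂μ) *
      (predCoef A Q x a k ω * predCoef A Q x b k ω)) μ := fun a b =>
    ((memLp_two_mul_of_memLp_four (memLp_predCoef hx a k)
      (memLp_predCoef hx b k)).integrable (by norm_num)).const_mul _
  simp only [chaosVar]
  rw [integral_finsetSum _ fun a _ => integrable_finsetSum _ fun b _ => hi1 a b,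
    integral_finsetSum _ fun a _ => integrable_finsetSum _ fun b _ => hi0 a b,
    ← Finset.sum_add_distrib]
  refine Finset.sum_congr rfl fun a _ => ?_
  rw [integral_finsetSum _ fun b _ => hi1 a b, integral_finsetSum _ fun b _ => hi0 a b,
    ← Finset.sum_add_distrib]
  refine Finset.sum_congr rfl fun b _ => ?_
  rw [integral_const_mul, integral_const_mul, ← mul_add]
  congr 1
  have e : ∀ ω, predCoef A Q x a k ω * predCoef A Q x b k ω
      = (A a k * A b k + (A a k * predCoef (fun _ _ => 0) Q x b k ω
        + A b k * predCoef (fun _ _ => 0) Q x a k ω))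
        + predCoef (fun _ _ => 0) Q x a k ω * predCoef (fun _ _ => 0) Q x b k ω := fun ω => by
    rw [hpred a, hpred b]; ring
  have j1 := (hp1 b).const_mul (A a k)
  have j2 := (hp1 a).const_mul (A b k)
  have h1 := integral_add ((integrable_const (A a k * A b k)).add (j1.add j2)) (hpp a b)
  have h2 := integral_add (integrable_const (μ := μ) (A a k * A b k)) (j1.add j2)
  have h3 := integral_add j1 j2
  simp only [Pi.add_apply] at h1 h2
  simp_rw [e]
  have k1 : ∫ ω, A a k * predCoef (fun _ _ => 0) Q x b k ω ∂μ = 0 := by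
    rw [integral_const_mul, hmean, mul_zero]
  have k2 : ∫ ω, A b k * predCoef (fun _ _ => 0) Q x a k ω ∂μ = 0 := by
    rw [integral_const_mul, hmean, mul_zero]
  rw [h1, h2, h3, k1, k2]
  simp

lemma integral_sq_sum_chaosDiff_eq (hm : ∀ i, m i ≤ mΩ) (hind : iIndep m μ)
    (hx : ∀ a, IsNoise μ m C (x a)) (hQ : ∀ a c k j, ¬ j < k → Q a c k j = 0) :
    ∫ ω, (∑ k, chaosDiff A Q x k ω) ^ 2 ∂μ
      = ∑ k, ∑ a, ∑ b, (∫ ω, x a k ω * x b k ω ∂μ) * (A a k * A b k)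
        + ∫ ω, (∑ k, chaosDiff (fun _ _ => 0) Q x k ω) ^ 2 ∂μ := by
  rw [integral_sq_sum_chaosDiff hm hind hx hQ, integral_sq_sum_chaosDiff hm hind hx hQ,
    ← Finset.sum_add_distrib]
  refine Finset.sum_congr rfl fun k _ => ?_
  rw [(isMartingaleDiff_chaos hm hind hx hQ).integral_sq_eq,
    (isMartingaleDiff_chaos hm hind hx hQ).integral_sq_eq, integral_chaosVar hx]

lemma integral_sum_chaosDiff (hm : ∀ i, m i ≤ mΩ) (hind : iIndep m μ)
    (hx : ∀ a, IsNoise μ m C (x a)) (hQ : ∀ a c k j, ¬ j < k → Q a c k j = 0) :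
    ∫ ω, ∑ k, chaosDiff A Q x k ω ∂μ = 0 := by
  have hM := isMartingaleDiff_chaos (A := A) hm hind hx hQ
  rw [integral_finsetSum _ fun k _ => (hM.memLp_diff k).integrable (by norm_num)]
  refine Finset.sum_eq_zero fun k _ => ?_
  have h := hM.integral_diff k (fun _ => 1) 1 (@measurable_const _ _ _ (past m k) _) (by simp)
  simp only [one_mul] at h
  rw [integral_complex_ofReal, Complex.ofReal_eq_zero] at h
  exact h

end

namespace IVModel

section

variable {n K L : ℕ} {Ω : Type*} [mΩ : MeasurableSpace Ω] {P : Measure Ω} [IsProbabilityMeasure P]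
  (M : IVModel n K L P) (G : Matrix (Fin n) (Fin n) ℝ) (β : ℝ)

/-- The information carried by the `i`-th observation. -/
abbrev obs (i : Fin n) : MeasurableSpace Ω :=
  MeasurableSpace.comap (fun ω => (M.Y i ω, M.X i ω)) inferInstance

omit [IsProbabilityMeasure P] in
lemma obs_le (i : Fin n) : M.obs i ≤ mΩ :=
  ((M.measurable_Y i).prodMk (M.measurable_X i)).comap_le

omit [IsProbabilityMeasure P] in
lemma iIndep_obs : iIndep M.obs P := M.indep

omit [IsProbabilityMeasure P] in
lemma measurable_η (i : Fin n) : Measurable[M.obs i] (M.η i) := by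
  have h : Measurable fun p : ℝ × ℝ => p.2 - M.R i := by fun_prop
  exact h.comp (comap_measurable _)

omit [IsProbabilityMeasure P] in
lemma measurable_ν (i : Fin n) : Measurable[M.obs i] (M.ν β i) := by
  have h : Measurable fun p : ℝ × ℝ => p.1 - M.RY i - (p.2 - M.R i) * β := by fun_prop
  exact h.comp (comap_measurable _)

lemma integral_η (i : Fin n) : ∫ ω, M.η i ω ∂P = 0 := by
  simp only [η]
  rw [integral_sub (M.integrable_X i) (integrable_const _), M.mean_X]
  simp [R]

lemma integral_ν (i : Fin n) : ∫ ω, M.ν β i ω ∂P = 0 := by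
  have hζ : Integrable (M.ζ i) P := (M.integrable_Y i).sub (integrable_const _)
  have hη : Integrable (M.η i) P := (M.integrable_X i).sub (integrable_const _)
  have hζ0 : ∫ ω, M.ζ i ω ∂P = 0 := by
    simp only [ζ]
    rw [integral_sub (M.integrable_Y i) (integrable_const _), M.mean_Y]
    simp [RY]
  simp only [ν]
  rw [integral_sub hζ (hη.mul_const β), integral_mul_const, hζ0, M.integral_η]
  simp

/-- The moment bounds in the regularity assumption, for one design. -/
def MomentBound (C : ℝ) : Prop := ∀ i, MemLp (M.η i) 4 P ∧ MemLp (M.ν β i) 4 P ∧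
  ∫ ω, M.η i ω ^ 4 ∂P + ∫ ω, M.ν β i ω ^ 4 ∂P ≤ C

/-- The variance and correlation bounds in the regularity assumption, for one design. -/
def NondegBound (δ : ℝ) : Prop := ∀ i, δ ≤ ∫ ω, M.ν β i ω ^ 2 ∂P ∧ δ ≤ ∫ ω, M.η i ω ^ 2 ∂P ∧
  |M.corr β i| ≤ 1 - δ

variable {M G β} {C δ : ℝ}

lemma MomentBound.isNoise (h : M.MomentBound β C) (a : Fin 2) :
    IsNoise P M.obs C (M.noise β a) := by
  have h4 : ∀ f : Ω → ℝ, 0 ≤ ∫ ω, f ω ^ 4 ∂P := fun f => integral_nonneg fun ω => by positivity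
  fin_cases a
  · exact ⟨M.measurable_ν β, fun i => (h i).2.1, M.integral_ν β, fun i => by
      have := h4 (M.η i); have := (h i).2.2
      change ∫ ω, M.ν β i ω ^ 4 ∂P ≤ C
      linarith⟩
  · exact ⟨M.measurable_η, fun i => (h i).1, M.integral_η, fun i => by
      have := h4 (M.ν β i); have := (h i).2.2
      change ∫ ω, M.η i ω ^ 4 ∂P ≤ C
      linarith⟩

lemma MomentBound.memLp_chaos (h : M.MomentBound β C) (c : Fin 3 → ℝ) :
    MemLp (M.chaos G β c) 2 P := by
  have hM := isMartingaleDiff_chaos (A := M.linCoef G β c) M.obs_le M.iIndep_obs h.isNoise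
    (quadCoef_eq_zero G c)
  exact memLp_finsetSum _ fun k _ => (hM.memLp_diff k).mono_exponent (by norm_num)

lemma MomentBound.integral_chaos (h : M.MomentBound β C) (c : Fin 3 → ℝ) :
    ∫ ω, M.chaos G β c ω ∂P = 0 :=
  integral_sum_chaosDiff M.obs_le M.iIndep_obs h.isNoise (quadCoef_eq_zero G c)

/-- A covariance matrix with variances at least `δ` and correlation at most `1 - δ` in absolute
value has smallest eigenvalue at least `δ ^ 2`. -/
lemma NondegBound.mul_sq_le (hδ : 0 < δ) (hm : M.MomentBound β C) (h : M.NondegBound β δ)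
    (i : Fin n) (a : Fin 2 → ℝ) :
    δ ^ 2 * (a 0 ^ 2 + a 1 ^ 2)
      ≤ ∑ p, ∑ q, (∫ ω, M.noise β p i ω * M.noise β q i ω ∂P) * (a p * a q) := by
  obtain ⟨hν, hη, hcorr⟩ := h i
  have hν2 : MemLp (M.ν β i) 2 P := (hm i).2.1.mono_exponent (by norm_num)
  have hη2 : MemLp (M.η i) 2 P := (hm i).1.mono_exponent (by norm_num)
  have vν : Var[M.ν β i; P] = ∫ ω, M.ν β i ω ^ 2 ∂P := by
    rw [variance_eq_integral hν2.1.aemeasurable, M.integral_ν]; simp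
  have vη : Var[M.η i; P] = ∫ ω, M.η i ω ^ 2 ∂P := by
    rw [variance_eq_integral hη2.1.aemeasurable, M.integral_η]; simp
  have hcov : cov[M.ν β i, M.η i; P] = ∫ ω, M.ν β i ω * M.η i ω ∂P := by
    rw [covariance, M.integral_ν, M.integral_η]; simp
  rw [corr, vν, vη, hcov] at hcorr
  simp only [Fin.sum_univ_two, noise, Matrix.cons_val_zero, Matrix.cons_val_one]
  have e1 : ∫ ω, M.η i ω * M.ν β i ω ∂P = ∫ ω, M.ν β i ω * M.η i ω ∂P := by
    simp_rw [mul_comm]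
  have e2 : ∫ ω, M.ν β i ω * M.ν β i ω ∂P = ∫ ω, M.ν β i ω ^ 2 ∂P := by simp_rw [sq]
  have e3 : ∫ ω, M.η i ω * M.η i ω ∂P = ∫ ω, M.η i ω ^ 2 ∂P := by simp_rw [sq]
  rw [e1, e2, e3]
  set p := ∫ ω, M.ν β i ω ^ 2 ∂P
  set q := ∫ ω, M.η i ω ^ 2 ∂P
  set r := ∫ ω, M.ν β i ω * M.η i ω ∂P
  have hsp : 0 < √p := Real.sqrt_pos.2 (by linarith)
  have hsq : 0 < √q := Real.sqrt_pos.2 (by linarith)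
  have hp2 := Real.sq_sqrt (show 0 ≤ p by linarith)
  have hq2 := Real.sq_sqrt (show 0 ≤ q by linarith)
  have hr : |r| ≤ (1 - δ) * (√p * √q) := by
    rw [abs_div, abs_of_pos (mul_pos hsp hsq), div_le_iff₀ (mul_pos hsp hsq)] at hcorr
    exact hcorr
  have hδ1 : 0 ≤ 1 - δ := (abs_nonneg _).trans hcorr
  have h1 : -(2 * r * (a 0 * a 1)) ≤ (1 - δ) * (a 0 ^ 2 * p + a 1 ^ 2 * q) := by
    calc -(2 * r * (a 0 * a 1)) ≤ |2 * r * (a 0 * a 1)| := neg_le_abs _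
      _ = 2 * |r| * (|a 0| * |a 1|) := by
          rw [abs_mul, abs_mul, abs_mul, abs_of_pos (two_pos : (0 : ℝ) < 2)]
      _ ≤ 2 * ((1 - δ) * (√p * √q)) * (|a 0| * |a 1|) := by gcongr
      _ = (1 - δ) * (2 * (|a 0| * √p) * (|a 1| * √q)) := by ring
      _ ≤ (1 - δ) * ((|a 0| * √p) ^ 2 + (|a 1| * √q) ^ 2) :=
          mul_le_mul_of_nonneg_left (two_mul_le_add_sq _ _) hδ1
      _ = (1 - δ) * (a 0 ^ 2 * p + a 1 ^ 2 * q) := by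
          rw [mul_pow, mul_pow, sq_abs, sq_abs, hp2, hq2]
  have h2 : δ * (a 0 ^ 2 + a 1 ^ 2) ≤ a 0 ^ 2 * p + a 1 ^ 2 * q := by
    nlinarith [mul_le_mul_of_nonneg_left hν (sq_nonneg (a 0)),
      mul_le_mul_of_nonneg_left hη (sq_nonneg (a 1))]
  nlinarith [mul_le_mul_of_nonneg_left h2 hδ.le]

lemma MomentBound.integral_sq_chaos_ge (hδ : 0 < δ) (hm : M.MomentBound β C)
    (h : M.NondegBound β δ) (c : Fin 3 → ℝ) :
    δ ^ 2 * (∑ k, M.linCoef G β c 0 k ^ 2 + ∑ k, M.linCoef G β c 1 k ^ 2)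
      + Var[M.quadPart G β c; P] ≤ ∫ ω, M.chaos G β c ω ^ 2 ∂P := by
  have e := integral_sq_sum_chaosDiff_eq (A := M.linCoef G β c) M.obs_le M.iIndep_obs
    hm.isNoise (quadCoef_eq_zero G c)
  have e0 : ∀ ω, ∑ k, chaosDiff (fun _ _ => 0) (quadCoef G c) (M.noise β) k ω
      = M.quadPart G β c ω := fun ω => by
    rw [sum_chaosDiff_quadCoef]
    simp
  simp_rw [e0] at e
  have hq : MemLp (M.quadPart G β c) 2 P := by
    have hM := isMartingaleDiff_chaos (A := fun _ _ => 0) M.obs_le M.iIndep_obs hm.isNoise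
      (quadCoef_eq_zero G c)
    have : MemLp (fun ω => ∑ k, chaosDiff (fun _ _ => 0) (quadCoef G c) (M.noise β) k ω) 2 P :=
      memLp_finsetSum _ fun k _ => (hM.memLp_diff k).mono_exponent (by norm_num)
    simpa only [e0] using this
  have hv := variance_le_expectation_sq (μ := P) hq.1
  simp only [Pi.pow_apply] at hv
  simp only [chaos]
  rw [e, ← Finset.sum_add_distrib, Finset.mul_sum]
  exact add_le_add (Finset.sum_le_sum fun k _ => h.mul_sq_le hδ hm k (fun a => M.linCoef G β c a k))
    hv

omit [IsProbabilityMeasure P] in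
/-- The nondegeneracy form is quadratic in the direction. -/
lemma nondegForm_smul (s c₁ c₂ c₃ : ℝ) :
    M.nondegForm G β (s * c₁) (s * c₂) (s * c₃) = s ^ 2 * M.nondegForm G β c₁ c₂ c₃ := by
  simp only [nondegForm]
  have e1 : (fun ω => ∑ i, ∑ j ∈ Finset.univ.erase i, G i j *
      (s * c₁ * M.ν β i ω * M.ν β j ω + s * c₂ * M.ν β i ω * M.η j ω + s * c₃ * M.η i ω * M.η j ω))
      = fun ω => s * ∑ i, ∑ j ∈ Finset.univ.erase i, G i j *
      (c₁ * M.ν β i ω * M.ν β j ω + c₂ * M.ν β i ω * M.η j ω + c₃ * M.η i ω * M.η j ω) := by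
    ext ω
    simp only [Finset.mul_sum]
    exact Finset.sum_congr rfl fun i _ => Finset.sum_congr rfl fun j _ => by ring
  have e2 : ∀ u v : Fin n → ℝ, ∀ a b : ℝ, ∑ i, (s * a * u i + s * b * v i) ^ 2
      = s ^ 2 * ∑ i, (a * u i + b * v i) ^ 2 := fun u v a b => by
    rw [Finset.mul_sum]
    exact Finset.sum_congr rfl fun i _ => by ring
  rw [e1, variance_const_mul, e2, e2]
  ring

omit [IsProbabilityMeasure P] in
lemma nondegForm_eq (c : Fin 3 → ℝ) :
    M.nondegForm G β (c 0) (c 1) (c 2) = 1 / M.rn G β *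
      (∑ k, M.linCoef G β c 0 k ^ 2 + ∑ k, M.linCoef G β c 1 k ^ 2
        + Var[M.quadPart G β c; P]) := by
  have : M.quadPart G β c = fun ω => ∑ i, ∑ j ∈ Finset.univ.erase i, G i j *
    (c 0 * M.ν β i ω * M.ν β j ω + c 1 * M.ν β i ω * M.η j ω + c 2 * M.η i ω * M.η j ω) := rfl
  simp only [nondegForm, this, linCoef, Matrix.cons_val_zero, Matrix.cons_val_one]
  ring

omit [IsProbabilityMeasure P] in
lemma rn_nonneg : 0 ≤ M.rn G β := by
  refine add_nonneg (add_nonneg ?_ ?_) ?_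
  · exact Finset.sum_nonneg fun _ _ => sq_nonneg _
  · exact Finset.sum_nonneg fun _ _ => sq_nonneg _
  · exact Finset.sum_nonneg fun _ _ => Finset.sum_nonneg fun _ _ => sq_nonneg _

omit [IsProbabilityMeasure P] in
/-- The nondegeneracy condition on the unit sphere forces `rₙ > 0`, since `1 / 0 = 0`. -/
lemma rn_pos {c₀ : ℝ} (hc₀ : 0 < c₀) (h : ∀ c₁ c₂ c₃ : ℝ, c₁ ^ 2 + c₂ ^ 2 + c₃ ^ 2 = 1 →
    c₀ ≤ M.nondegForm G β c₁ c₂ c₃) : 0 < M.rn G β := by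
  refine lt_of_le_of_ne rn_nonneg fun h0 => ?_
  have := h 1 0 0 (by norm_num)
  rw [nondegForm, ← h0] at this
  simp at this
  linarith

lemma MomentBound.le_integral_sq_chaos {c₀ : ℝ} (hc₀ : 0 < c₀)
    (hn : ∀ c₁ c₂ c₃ : ℝ, c₁ ^ 2 + c₂ ^ 2 + c₃ ^ 2 = 1 → c₀ ≤ M.nondegForm G β c₁ c₂ c₃)
    (hδ : 0 < δ) (hm : M.MomentBound β C) (h : M.NondegBound β δ) (c : Fin 3 → ℝ) :
    min (δ ^ 2) 1 * c₀ * (M.rn G β * ∑ i, c i ^ 2) ≤ ∫ ω, M.chaos G β c ω ^ 2 ∂P := by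
  have hr := rn_pos hc₀ hn
  have h1 := hm.integral_sq_chaos_ge (G := G) hδ h c
  have h2 : c₀ * ∑ i, c i ^ 2 ≤ M.nondegForm G β (c 0) (c 1) (c 2) := by
    rcases (Finset.sum_nonneg fun i (_ : i ∈ Finset.univ) => sq_nonneg (c i)).eq_or_lt with h0 | h0
    · rw [← h0, mul_zero, nondegForm_eq]
      refine mul_nonneg (by positivity) (add_nonneg (add_nonneg ?_ ?_) (variance_nonneg _ _))
      · exact Finset.sum_nonneg fun _ _ => sq_nonneg _
      · exact Finset.sum_nonneg fun _ _ => sq_nonneg _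
    · set s := √(∑ i, c i ^ 2) with hs
      have hs0 : 0 < s := Real.sqrt_pos.2 h0
      have hs2 : s ^ 2 = ∑ i, c i ^ 2 := Real.sq_sqrt h0.le
      have hu := hn (c 0 / s) (c 1 / s) (c 2 / s) (by
        rw [div_pow, div_pow, div_pow, ← add_div, ← add_div, hs2, Fin.sum_univ_three]
        rw [Fin.sum_univ_three] at h0
        exact div_self h0.ne')
      have e := nondegForm_smul (M := M) (G := G) (β := β) s (c 0 / s) (c 1 / s) (c 2 / s)
      rw [mul_div_cancel₀ _ hs0.ne', mul_div_cancel₀ _ hs0.ne', mul_div_cancel₀ _ hs0.ne', hs2] at e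
      rw [e, mul_comm]
      exact mul_le_mul_of_nonneg_left hu h0.le
  rw [nondegForm_eq, one_div_mul_eq_div, le_div_iff₀ hr] at h2
  set a := ∑ k, M.linCoef G β c 0 k ^ 2 + ∑ k, M.linCoef G β c 1 k ^ 2
  have ha : 0 ≤ a := add_nonneg (Finset.sum_nonneg fun _ _ => sq_nonneg _)
    (Finset.sum_nonneg fun _ _ => sq_nonneg _)
  have hv := variance_nonneg (M.quadPart G β c) P
  have hmin0 : 0 ≤ min (δ ^ 2) 1 := le_min (sq_nonneg _) zero_le_one
  calc _ = min (δ ^ 2) 1 * ((c₀ * ∑ i, c i ^ 2) * M.rn G β) := by ring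
    _ ≤ min (δ ^ 2) 1 * (a + Var[M.quadPart G β c; P]) := mul_le_mul_of_nonneg_left h2 hmin0
    _ ≤ δ ^ 2 * a + Var[M.quadPart G β c; P] := by
        nlinarith [mul_le_mul_of_nonneg_right (min_le_left (δ ^ 2) 1) ha,
          mul_le_mul_of_nonneg_right (min_le_right (δ ^ 2) 1) hv]
    _ ≤ _ := h1

end

end IVModel

/-! ### The covariance matrix and its inverse square root -/

section

open scoped MatrixOrder

variable {V : Matrix (Fin 3) (Fin 3) ℝ}

lemma mulVec_dotProduct_eq {ι : Type*} [Fintype ι] (A : Matrix ι ι ℝ) (u x : ι → ℝ) :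
    (A *ᵥ u) ⬝ᵥ x = u ⬝ᵥ (Aᵀ *ᵥ x) := by
  rw [Matrix.dotProduct_mulVec, Matrix.vecMul_transpose]

lemma invSqrt_transpose : (invSqrt V)ᵀ = invSqrt V := by
  have h : (CFC.sqrt V).PosSemidef := Matrix.nonneg_iff_posSemidef.1 (CFC.sqrt_nonneg V)
  have h1 : (CFC.sqrt V)ᵀ = CFC.sqrt V := by simpa using h.isHermitian.eq
  rw [invSqrt, Matrix.transpose_nonsing_inv, h1]

lemma invSqrt_mul_mul_invSqrt (hV : V.PosDef) : invSqrt V * V * invSqrt V = 1 := by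
  have h0 : 0 ≤ V := Matrix.nonneg_iff_posSemidef.2 hV.posSemidef
  have h1 : CFC.sqrt V * CFC.sqrt V = V := CFC.sqrt_mul_sqrt_self V h0
  have hdet : IsUnit (CFC.sqrt V).det := by
    refine isUnit_iff_ne_zero.2 fun h => hV.det_pos.ne' ?_
    rw [← h1, Matrix.det_mul, h, mul_zero]
  rw [invSqrt]
  nth_rewrite 2 [← h1]
  rw [← Matrix.mul_assoc, Matrix.nonsing_inv_mul _ hdet, Matrix.one_mul,
    Matrix.mul_nonsing_inv _ hdet]

lemma invSqrt_mulVec_dotProduct (hV : V.PosDef) (u : Fin 3 → ℝ) :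
    (invSqrt V *ᵥ u) ⬝ᵥ (V *ᵥ (invSqrt V *ᵥ u)) = u ⬝ᵥ u := by
  rw [mulVec_dotProduct_eq, invSqrt_transpose, Matrix.mulVec_mulVec, Matrix.mulVec_mulVec,
    invSqrt_mul_mul_invSqrt hV, Matrix.one_mulVec]

end

namespace IVModel

section

variable {n K L : ℕ} {Ω : Type*} [mΩ : MeasurableSpace Ω] {P : Measure Ω} [IsProbabilityMeasure P]
  {M : IVModel n K L P} {G : Matrix (Fin n) (Fin n) ℝ} {β C δ : ℝ}

omit [IsProbabilityMeasure P] in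
lemma measurable_T (a : Fin 3) : Measurable (fun ω => M.T G β ω a) := by
  have hoff : ∀ f g : Fin n → Ω → ℝ, (∀ i, Measurable (f i)) → (∀ i, Measurable (g i)) →
      Measurable fun ω => 1 / √(K : ℝ) * offSum G (fun i => f i ω) (fun i => g i ω) :=
    fun f g hf hg => by
      simp only [offSum]
      exact (Finset.measurable_fun_sum _ fun i _ => Finset.measurable_fun_sum _ fun j _ =>
        ((hf i).const_mul _).mul (hg j)).const_mul _
  have he : ∀ i, Measurable (M.e β i) := fun i =>
    (M.measurable_Y i).sub ((M.measurable_X i).mul_const _)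
  fin_cases a
  · exact hoff _ _ he he
  · exact hoff _ _ he M.measurable_X
  · exact hoff _ _ M.measurable_X M.measurable_X

omit [IsProbabilityMeasure P] in
lemma chaos_eq (hK : 0 < K) (hG : offSum G M.R M.R ≠ 0) (hβ : β = M.betaJIVE G) (w : Fin 3 → ℝ)
    (ω : Ω) : M.chaos G β (fun a => w a / √(K : ℝ)) ω
      = ∑ a, w a * (M.T G β ω - M.center G β) a := by
  have hs : (√(K : ℝ)) ≠ 0 := (Real.sqrt_pos.2 (Nat.cast_pos.2 hK)).ne'
  have h := M.sum_mul_T_sub_center G β hG hβ (fun a => w a / √(K : ℝ)) ω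
  have h2 : M.chaos G β (fun a => w a / √(K : ℝ)) ω
      = √(K : ℝ) * ∑ a, w a / √(K : ℝ) * (M.T G β ω - M.center G β) a := by
    rw [h]; field_simp
  rw [h2, Finset.mul_sum]
  refine Finset.sum_congr rfl fun a _ => ?_
  field_simp

lemma dotProduct_V_mulVec (hK : 0 < K) (hG : offSum G M.R M.R ≠ 0) (hβ : β = M.betaJIVE G)
    (hm : M.MomentBound β C) (w : Fin 3 → ℝ) :
    w ⬝ᵥ (M.V G β *ᵥ w) = ∫ ω, M.chaos G β (fun a => w a / √(K : ℝ)) ω ^ 2 ∂P := by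
  have hT : ∀ a, MemLp (fun ω => M.T G β ω a) 2 P := fun a => by
    have e : (fun ω => M.T G β ω a) = fun ω => M.chaos G β
        (fun b => (Pi.single a 1 : Fin 3 → ℝ) b / √(K : ℝ)) ω + M.center G β a := by
      ext ω
      rw [chaos_eq hK hG hβ, Finset.sum_eq_single a (fun b _ hb => by simp [hb]) (by simp)]
      simp
    rw [e]
    exact (hm.memLp_chaos _).add (memLp_const _)
  have hc := hm.memLp_chaos (G := G) (fun a => w a / √(K : ℝ))
  have e1 : (fun ω => ∑ a, w a * M.T G β ω a)
      = fun ω => ∑ a, w a * M.center G β a + M.chaos G β (fun a => w a / √(K : ℝ)) ω := by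
    ext ω
    rw [chaos_eq hK hG hβ, ← Finset.sum_add_distrib]
    exact Finset.sum_congr rfl fun a _ => by rw [Pi.sub_apply]; ring
  have e2 : Var[fun ω => ∑ a, w a * M.T G β ω a; P]
      = ∫ ω, M.chaos G β (fun a => w a / √(K : ℝ)) ω ^ 2 ∂P := by
    rw [e1, variance_const_add hc.1, variance_eq_integral hc.1.aemeasurable, hm.integral_chaos]
    simp
  have hS : MemLp (fun ω => ∑ a, w a * M.T G β ω a) 2 P :=
    memLp_finsetSum _ fun a _ => (hT a).const_mul _
  rw [← e2, ← covariance_self hS.1.aemeasurable,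
    covariance_fun_sum_fun_sum (fun a => (hT a).const_mul _) (fun a => (hT a).const_mul _)]
  simp only [dotProduct, Matrix.mulVec, V, Matrix.of_apply, Finset.mul_sum,
    covariance_const_mul_left, covariance_const_mul_right]
  exact Finset.sum_congr rfl fun a _ => Finset.sum_congr rfl fun b _ => by ring

lemma posDef_V (hK : 0 < K) (hG : offSum G M.R M.R ≠ 0) (hβ : β = M.betaJIVE G) {c₀ : ℝ}
    (hc₀ : 0 < c₀)
    (hn : ∀ c₁ c₂ c₃ : ℝ, c₁ ^ 2 + c₂ ^ 2 + c₃ ^ 2 = 1 → c₀ ≤ M.nondegForm G β c₁ c₂ c₃)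
    (hδ : 0 < δ) (hm : M.MomentBound β C) (h : M.NondegBound β δ) : (M.V G β).PosDef := by
  refine Matrix.PosDef.of_dotProduct_mulVec_pos ?_ fun w hw => ?_
  · ext a b
    simp only [V, Matrix.conjTranspose_apply, Matrix.of_apply, star_trivial]
    exact covariance_comm _ _
  · rw [star_trivial, dotProduct_V_mulVec hK hG hβ hm]
    refine lt_of_lt_of_le ?_ (hm.le_integral_sq_chaos hc₀ hn hδ h _)
    have hs : 0 < √(K : ℝ) := Real.sqrt_pos.2 (Nat.cast_pos.2 hK)
    obtain ⟨a, ha⟩ := Function.ne_iff.1 hw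
    have h1 : 0 < ∑ i, (w i / √(K : ℝ)) ^ 2 := by
      refine Finset.sum_pos' (fun i _ => sq_nonneg _) ⟨a, Finset.mem_univ a, ?_⟩
      have : w a / √(K : ℝ) ≠ 0 := div_ne_zero ha hs.ne'
      positivity
    have h2 := rn_pos hc₀ hn
    have h3 : 0 < min (δ ^ 2) 1 := lt_min (by positivity) one_pos
    positivity

omit [IsProbabilityMeasure P] in
/-- Fourth powers of the linear coefficients are controlled by the leave-one-out sums. -/
lemma sum_linCoef_pow_four_le {c : Fin 3 → ℝ} {s : ℝ} (hc : ∑ i, c i ^ 2 ≤ s) :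
    ∑ a, ∑ k, M.linCoef G β c a k ^ 4 ≤ 54 * s ^ 2 * ∑ i, (looSum G M.R i ^ 4
      + looSum G (M.RΔ β) i ^ 4 + looSum Gᵀ M.R i ^ 4 + looSum Gᵀ (M.RΔ β) i ^ 4) := by
  have hci : ∀ i, c i ^ 2 ≤ s := fun i =>
    (Finset.single_le_sum (f := fun i => c i ^ 2) (fun _ _ => sq_nonneg _)
      (Finset.mem_univ i)).trans hc
  have key : ∀ (p q : Fin 3) (x y z : ℝ), (c p * (x + y) + c q * z) ^ 4
      ≤ 27 * s ^ 2 * (x ^ 4 + y ^ 4 + z ^ 4) := fun p q x y z => by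
    have h1 : (c p * (x + y) + c q * z) ^ 2 ≤ 3 * (s * (x ^ 2 + y ^ 2 + z ^ 2)) := by
      have h3 := mul_le_mul_of_nonneg_right (hci p) (sq_nonneg x)
      have h4 := mul_le_mul_of_nonneg_right (hci p) (sq_nonneg y)
      have h5 := mul_le_mul_of_nonneg_right (hci q) (sq_nonneg z)
      nlinarith [sq_nonneg (c p * x - c p * y), sq_nonneg (c p * x - c q * z),
        sq_nonneg (c p * y - c q * z)]
    have h2 : ((c p * (x + y) + c q * z) ^ 2) ^ 2 ≤ (3 * (s * (x ^ 2 + y ^ 2 + z ^ 2))) ^ 2 :=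
      pow_le_pow_left₀ (sq_nonneg _) h1 2
    have h6 : (x ^ 2 + y ^ 2 + z ^ 2) ^ 2 ≤ 3 * (x ^ 4 + y ^ 4 + z ^ 4) := by
      nlinarith [sq_nonneg (x ^ 2 - y ^ 2), sq_nonneg (x ^ 2 - z ^ 2), sq_nonneg (y ^ 2 - z ^ 2)]
    have h7 := mul_le_mul_of_nonneg_left h6 (sq_nonneg s)
    calc _ = ((c p * (x + y) + c q * z) ^ 2) ^ 2 := by ring
      _ ≤ (3 * (s * (x ^ 2 + y ^ 2 + z ^ 2))) ^ 2 := h2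
      _ = 9 * (s ^ 2 * (x ^ 2 + y ^ 2 + z ^ 2) ^ 2) := by ring
      _ ≤ 9 * (s ^ 2 * (3 * (x ^ 4 + y ^ 4 + z ^ 4))) := by linarith
      _ = _ := by ring
  rw [Fin.sum_univ_two, ← Finset.sum_add_distrib, Finset.mul_sum]
  refine Finset.sum_le_sum fun k _ => ?_
  simp only [linCoef, sum_erase_add_transpose_mul, Matrix.cons_val_zero, Matrix.cons_val_one]
  have h1 := key 0 1 (looSum G (M.RΔ β) k) (looSum Gᵀ (M.RΔ β) k) (looSum G M.R k)
  have h2 := key 2 1 (looSum G M.R k) (looSum Gᵀ M.R k) (looSum Gᵀ (M.RΔ β) k)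
  have h4 : ∀ x : ℝ, 0 ≤ 27 * s ^ 2 * x ^ 4 := fun x => by positivity
  have := h4 (looSum G (M.RΔ β) k)
  have := h4 (looSum Gᵀ M.R k)
  linarith

/-- The characteristic function of a combination of the centered statistics with variance `v` is
close to the Gaussian one, in terms of the weight conditions `d` and `q` on the linear and the
quadratic part. The variance bounds `rₙ |c|²` and the squared linear coefficients. -/
lemma norm_charFun_chaos_sub_le {c₀ : ℝ} (hc₀ : 0 < c₀)
    (hn : ∀ c₁ c₂ c₃ : ℝ, c₁ ^ 2 + c₂ ^ 2 + c₃ ^ 2 = 1 → c₀ ≤ M.nondegForm G β c₁ c₂ c₃)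
    (hδ : 0 < δ) (hC : 1 ≤ C) (hm : M.MomentBound β C) (h : M.NondegBound β δ) {c : Fin 3 → ℝ}
    {v κ d q ε : ℝ} (hv : ∫ ω, M.chaos G β c ω ^ 2 ∂P = v) (hκ : κ = v / (min (δ ^ 2) 1 * c₀))
    (hd : d = 1 / M.rn G β ^ 2 * ∑ i, (looSum G M.R i ^ 4
      + looSum G (M.RΔ β) i ^ 4 + looSum Gᵀ M.R i ^ 4 + looSum Gᵀ (M.RΔ β) i ^ 4))
    (hq : q = frobNorm ((1 / M.rn G β) • (lowerPart G * (lowerPart G)ᵀ))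
      + frobNorm ((1 / M.rn G β) • (upperPart G * (upperPart G)ᵀ))) (hε : 0 < ε) :
    ‖∫ ω, Complex.exp ((M.chaos G β c ω : ℝ) * Complex.I) ∂P - (Real.exp (-v / 2) : ℝ)‖
      ≤ 2 * (4 * (ε * v + ε⁻¹ * (216 * C ^ 2 * (54 * κ ^ 2 * d + 40 * C ^ 2 * (16 * κ ^ 2 * q ^ 2))))
        + 216 * C ^ 2 * (54 * κ ^ 2 * d + 40 * C ^ 2 * (16 * κ ^ 2 * q ^ 2))
        + 2 * √(11664 * C ^ 4 * (16 * κ ^ 2 * q ^ 2 + √(16 * κ ^ 2 * q ^ 2) * (v / δ ^ 2)))) := by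
  have hr := rn_pos hc₀ hn
  have hlow := hm.le_integral_sq_chaos hc₀ hn hδ h c
  have hge := hm.integral_sq_chaos_ge (G := G) hδ h c
  rw [hv] at hlow hge
  have hmin : 0 < min (δ ^ 2) 1 * c₀ := mul_pos (lt_min (by positivity) one_pos) hc₀
  have hs : ∑ i, c i ^ 2 ≤ κ / M.rn G β := by
    rw [hκ, le_div_iff₀ hr, le_div_iff₀ hmin]
    linarith
  have hs0 : 0 ≤ κ / M.rn G β := (Finset.sum_nonneg fun _ _ => sq_nonneg _).trans hs
  refine JIVE.norm_charFun_chaos_sub_le (A := M.linCoef G β c) M.obs_le M.iIndep_obs hC hm.isNoise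
    (quadCoef_eq_zero G c) (fun a b => ?_) (fun a => ?_) ?_ hε hv
  · have hci : ∀ i, c i ^ 2 ≤ κ / M.rn G β := fun i =>
      (Finset.single_le_sum (f := fun i => c i ^ 2) (fun _ _ => sq_nonneg _)
        (Finset.mem_univ i)).trans hs
    refine (gramSq_quadCoef_le G hci a b).trans ?_
    have e1 := frobNorm_smul_mul_transpose (1 / M.rn G β) (lowerPart G)
    have e2 := frobNorm_smul_mul_transpose (1 / M.rn G β) (upperPart G)
    have n1 : 0 ≤ frobNorm ((1 / M.rn G β) • (lowerPart G * (lowerPart G)ᵀ)) :=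
      frobNorm_nonneg _
    have n2 : 0 ≤ frobNorm ((1 / M.rn G β) • (upperPart G * (upperPart G)ᵀ)) :=
      frobNorm_nonneg _
    have e3 : (1 / M.rn G β) ^ 2 * (gramSq (lowerPart G) + gramSq (upperPart G)) ≤ q ^ 2 := by
      rw [mul_add, ← e1, ← e2, hq]
      nlinarith [mul_nonneg n1 n2]
    calc 16 * (κ / M.rn G β) ^ 2 * (gramSq (lowerPart G) + gramSq (upperPart G))
        = 16 * κ ^ 2 * ((1 / M.rn G β) ^ 2 * (gramSq (lowerPart G) + gramSq (upperPart G))) := by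
          ring
      _ ≤ 16 * κ ^ 2 * q ^ 2 := mul_le_mul_of_nonneg_left e3 (by positivity)
  · rw [le_div_iff₀ (by positivity), mul_comm]
    refine le_trans ?_ hge
    have hvar := variance_nonneg (M.quadPart G β c) P
    have p0 : 0 ≤ δ ^ 2 * ∑ k, M.linCoef G β c 0 k ^ 2 :=
      mul_nonneg (sq_nonneg _) (Finset.sum_nonneg fun _ _ => sq_nonneg _)
    have p1 : 0 ≤ δ ^ 2 * ∑ k, M.linCoef G β c 1 k ^ 2 :=
      mul_nonneg (sq_nonneg _) (Finset.sum_nonneg fun _ _ => sq_nonneg _)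
    fin_cases a
    · simp only [Fin.zero_eta]; linarith
    · simp only [Fin.mk_one]; linarith
  · refine (sum_linCoef_pow_four_le hs).trans (le_of_eq ?_)
    rw [hd]
    ring

end

end IVModel

/-! ### The limit -/

/-- The error bound of the quantitative central limit theorem vanishes in the limit. -/
lemma tendsto_of_error_bound {f : ℕ → ℂ} {z : ℂ} {d q : ℕ → ℝ} {v κ C D : ℝ} (hv : 0 ≤ v)
    (hd : Tendsto d atTop (nhds 0)) (hq : Tendsto q atTop (nhds 0))
    (h : ∀ ε : ℝ, 0 < ε → ∀ᶠ t in atTop, ‖f t - z‖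
      ≤ 2 * (4 * (ε * v + ε⁻¹ * (216 * C ^ 2 *
          (54 * κ ^ 2 * d t + 40 * C ^ 2 * (16 * κ ^ 2 * q t ^ 2))))
        + 216 * C ^ 2 * (54 * κ ^ 2 * d t + 40 * C ^ 2 * (16 * κ ^ 2 * q t ^ 2))
        + 2 * √(11664 * C ^ 4 * (16 * κ ^ 2 * q t ^ 2 + √(16 * κ ^ 2 * q t ^ 2) * D)))) :
    Tendsto f atTop (nhds z) := by
  rw [Metric.tendsto_nhds]
  intro e he
  set ε := e / (16 * (v + 1)) with hεdef
  have hε : 0 < ε := by positivity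
  set F : ℝ × ℝ → ℝ := fun p => 2 * (4 * (ε * v + ε⁻¹ * (216 * C ^ 2 *
          (54 * κ ^ 2 * p.1 + 40 * C ^ 2 * (16 * κ ^ 2 * p.2 ^ 2))))
        + 216 * C ^ 2 * (54 * κ ^ 2 * p.1 + 40 * C ^ 2 * (16 * κ ^ 2 * p.2 ^ 2))
        + 2 * √(11664 * C ^ 4 * (16 * κ ^ 2 * p.2 ^ 2 + √(16 * κ ^ 2 * p.2 ^ 2) * D))) with hF
  have hFc : Continuous F := by fun_prop
  have hF0 : F (0, 0) < e := by
    have h1 : F (0, 0) = 8 * (ε * v) := by simp [hF]; ring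
    have h2 : ε * (16 * (v + 1)) = e := div_mul_cancel₀ _ (by positivity)
    rw [h1]
    nlinarith
  have hlim : Tendsto (fun t => F (d t, q t)) atTop (nhds (F (0, 0))) :=
    (hFc.tendsto _).comp (hd.prodMk_nhds hq)
  filter_upwards [h ε hε, hlim.eventually (gt_mem_nhds hF0)] with t h1 h2
  rw [dist_eq_norm]
  exact lt_of_le_of_lt h1 h2

end JIVE

theorem theorem1 {Ω : ℕ → Type*} [∀ t, MeasurableSpace (Ω t)]
    (P : ∀ t, Measure (Ω t)) [∀ t, IsProbabilityMeasure (P t)]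
    (n K L : ℕ → ℕ) (hK : ∀ t, 0 < K t)
    (M : ∀ t, JIVE.IVModel (n t) (K t) (L t) (P t))
    (G : ∀ t, Matrix (Fin (n t)) (Fin (n t)) ℝ)
    (hG : ∀ t, JIVE.offSum (G t) (M t).R (M t).R ≠ 0)
    (β β₀ : ℕ → ℝ)
    (hβ : ∀ t, β t = (M t).betaJIVE (G t))
    (hA : JIVE.NormalityAssumption M G β)
    (hnull : ∀ t, β t = β₀ t) :
    (∀ t ω, JIVE.offSum (G t) (fun i => (M t).X i ω) (fun i => (M t).X i ω) ≠ 0 →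
      (M t).betaHat (G t) ω - (M t).betaJIVE (G t)
        = (M t).TLM (G t) (β₀ t) ω / (M t).TFS (G t) ω) ∧
    (∀ᶠ t in atTop, ((M t).V (G t) (β₀ t)).PosDef) ∧
    TendstoInDistribution
      (fun t ω => (WithLp.toLp 2 (JIVE.invSqrt ((M t).V (G t) (β₀ t)) *ᵥ
        ((M t).T (G t) (β₀ t) ω - (M t).center (G t) (β t))) : EuclideanSpace ℝ (Fin 3)))
      atTop id P (stdGaussian (EuclideanSpace ℝ (Fin 3))) := by
  obtain rfl : β = β₀ := funext hnull
  obtain ⟨C, hC⟩ := hA.moments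
  obtain ⟨δ, hδ, hδ'⟩ := hA.nondeg_errors
  obtain ⟨c₀, hc₀, hn⟩ := hA.nondeg_var
  have hm : ∀ᶠ t in atTop, (M t).MomentBound (β t) (max C 1) := by
    filter_upwards [hC] with t ht i
    exact ⟨(ht i).1, (ht i).2.1, (ht i).2.2.trans (le_max_left _ _)⟩
  have hV : ∀ᶠ t in atTop, ((M t).V (G t) (β t)).PosDef := by
    filter_upwards [hm, hδ', hn] with t h1 h2 h3
    exact JIVE.IVModel.posDef_V (hK t) (hG t) (hβ t) hc₀ h3 hδ h1 h2
  refine ⟨fun t ω hX => ?_, hV, ?_⟩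
  · have hs : √(K t : ℝ) ≠ 0 := (Real.sqrt_pos.2 (Nat.cast_pos.2 (hK t))).ne'
    have he : (fun i => (M t).e (β t) i ω) = fun i => (M t).Y i ω - (M t).X i ω * β t := rfl
    rw [← hβ t, JIVE.IVModel.betaHat, JIVE.IVModel.TLM, JIVE.IVModel.TFS, he,
      JIVE.offSum_sub_mul_left]
    field_simp
  · have hmeas : ∀ t, Measurable (fun ω => (WithLp.toLp 2 (JIVE.invSqrt ((M t).V (G t) (β t)) *ᵥ
        ((M t).T (G t) (β t) ω - (M t).center (G t) (β t))) : EuclideanSpace ℝ (Fin 3))) :=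
      fun t => by
        have hT : Measurable ((M t).T (G t) (β t)) :=
          measurable_pi_iff.2 fun a => JIVE.IVModel.measurable_T a
        fun_prop
    refine ⟨fun t => (hmeas t).aemeasurable, aemeasurable_id, ?_⟩
    refine ProbabilityMeasure.tendsto_iff_tendsto_charFun.2 fun u => ?_
    simp only [ProbabilityMeasure.coe_mk, Measure.map_id, charFun_stdGaussian]
    set w : ∀ t, Fin 3 → ℝ := fun t => JIVE.invSqrt ((M t).V (G t) (β t)) *ᵥ u.ofLp with hw
    -- by symmetry of `V ^ (-1/2)` the projection on `u` is the combination with weights `w`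
    have hchar : ∀ t, charFun ((P t).map (fun ω =>
        (WithLp.toLp 2 (JIVE.invSqrt ((M t).V (G t) (β t)) *ᵥ
          ((M t).T (G t) (β t) ω - (M t).center (G t) (β t))) : EuclideanSpace ℝ (Fin 3)))) u
        = ∫ ω, Complex.exp (((M t).chaos (G t) (β t) (fun a => w t a / √(K t : ℝ)) ω : ℝ)
          * Complex.I) ∂(P t) := fun t => by
      rw [charFun_apply, integral_map (hmeas t).aemeasurable (by fun_prop)]
      refine integral_congr_ae (ae_of_all _ fun ω => ?_)
      simp only
      congr 3
      rw [JIVE.IVModel.chaos_eq (hK t) (hG t) (hβ t)]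
      have e1 : ∀ x : Fin 3 → ℝ, inner ℝ (WithLp.toLp 2 x) u = u.ofLp ⬝ᵥ x := fun x => by
        simp [PiLp.inner_apply, dotProduct]
      rw [e1, ← JIVE.invSqrt_transpose, ← JIVE.mulVec_dotProduct_eq]
      rfl
    have hv : ∀ᶠ t in atTop, ∫ ω, (M t).chaos (G t) (β t) (fun a => w t a / √(K t : ℝ)) ω ^ 2 ∂(P t)
        = ‖u‖ ^ 2 := by
      filter_upwards [hm, hV] with t h1 h2
      rw [← JIVE.IVModel.dotProduct_V_mulVec (hK t) (hG t) (hβ t) h1, hw,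
        JIVE.invSqrt_mulVec_dotProduct h2, EuclideanSpace.real_norm_sq_eq]
      simp [dotProduct, sq]
    have hz : Complex.exp (-(‖u‖ : ℂ) ^ 2 / 2) = ((Real.exp (-‖u‖ ^ 2 / 2) : ℝ) : ℂ) := by
      push_cast; rfl
    rw [hz]
    simp_rw [hchar]
    refine JIVE.tendsto_of_error_bound (sq_nonneg ‖u‖) hA.linear_weights hA.quadratic_weights
      (C := max C 1) (κ := ‖u‖ ^ 2 / (min (δ ^ 2) 1 * c₀)) (D := ‖u‖ ^ 2 / δ ^ 2) fun ε hε => ?_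
    filter_upwards [hm, hδ', hn, hv] with t h1 h2 h3 h4
    exact JIVE.IVModel.norm_charFun_chaos_sub_le hc₀ h3 hδ (le_max_right _ _) h1 h2 h4 rfl rfl rfl
      hε
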